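/- Let $B\in(0,\infty)$ (the Bond number) and $V>0$. Let $\mathcal M_V$ be the set of all $h:[0,1]\to\mathbb R$ that are continuous and piecewise continuously differentiable (that is, $C^1$, with one-sided derivatives at the end points, on each closed interval of some finite partition of $[0,1]$), with $h\ge 0$ on $[0,1]$ and $\int_0^1 h\,r\,dr=V/(2\pi)$. Let $H_1^1(0,1)$ be the space of functions $u$ on $(0,1)$ with a weak derivative $u'$ such that $\int_0^1 (u^2+(u')^2)\,r\,dr<\infty$. For $h\in\mathcal M_V$, the fundamental frequency for $m=0$ (radial motion) of the shallow radially symmetric container with bottom $z=-h(r)$, with surface tension and pinned contact line, is $$\Omega_{0,1}(h)=\inf\Big\{\tfrac12\int_0^1 h\,(\psi')^2\,r\,dr+\tfrac12\int_0^1\Big[\zeta^2+\tfrac1B(\zeta')^2\Big]r\,dr\Big\},$$ the infimum being over all $\psi,\zeta\in H_1^1(0,1)$ with $\zeta(1)=0$ (in the sense of traces), $\int_0^1\zeta\,r\,dr=0$ and $\int_0^1\psi\zeta\,r\,dr=1$. Put $\lambda_{0,1}(h)=\Omega_{0,1}(h)^2$. Let $I_n$ and $\mathbf L_n$ be the modified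 Bessel and the modified Struve function of the first kind of order $n$, and let ${}_2F_3$ be the generalized hypergeometric function. Define $$\Upsilon(\kappa)=I_1(\kappa)\mathbf L_0(\kappa)-I_0(\kappa)\mathbf L_1(\kappa),\qquad d_0=\frac{3\pi\Upsilon(\sqrt B)+2B\,I_0(\sqrt B)-6\sqrt B\,I_1(\sqrt B)}{3B\,I_2(\sqrt B)},$$ $$\lambda_{0,1}^*=\frac{18V}{\pi}\bigg[6d_0-3+\frac{18(1-d_0)\pi\Upsilon(\sqrt B)}{B\,I_0(\sqrt B)}+3\,{}_2F_3\Big(1,2;\tfrac32,\tfrac52,3;\tfrac B4\Big)-\frac{9\pi^2\mathbf L_0(\sqrt B)\Upsilon(\sqrt B)}{B^{3/2}I_0(\sqrt B)}\bigg]^{-1},$$ $$h_0^*(r)=\frac{\lambda_{0,1}^*}{3}\Big[\frac{3d_0r}{2}-r^2\Big]+\frac{\lambda_{0,1}^*(1-d_0)I_1(\sqrt B\,r)}{\sqrt B\,I_0(\sqrt B)}+\frac{\lambda_{0,1}^*\pi}{2B}\Big[\mathbf L_1(\sqrt B\,r)-\frac{\mathbf L_0(\sqrt B)I_1(\sqrt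 B\,r)}{I_0(\sqrt B)}\Big].$$ Then $\lambda_{0,1}(h)\le\lambda_{0,1}^*$ for every $h\in\mathcal M_V$. Moreover $h_0^*\in\mathcal M_V$ and equality holds for it: $\lambda_{0,1}(h_0^*)=\lambda_{0,1}^*$. Finally, $h_0^*(0)=0$, and the function $-h_0^*$ is not convex on $[0,1]$. -/

import Mathlib

open Set MeasureTheory
open scoped Nat ContDiff

noncomputable section

namespace Sloshing

/-! ### Special functions -/

/-- Modified Bessel function of the first kind, of integer order `n`. -/
def besselI (n : ℕ) (x : ℝ) : ℝ :=
  ∑' k : ℕ, (x / 2) ^ (2 * k + n) / ((k ! : ℝ) * ((k + n)! : ℝ))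

/-- Modified Struve function of the first kind, of integer order `n`. -/
def struveL (n : ℕ) (x : ℝ) : ℝ :=
  ∑' k : ℕ, (x / 2) ^ (2 * k + n + 1) /
    (Real.Gamma ((k : ℝ) + 3 / 2) * Real.Gamma ((k : ℝ) + (n : ℝ) + 3 / 2))

/-- Generalized hypergeometric function `pFq(a; b; z)`, with upper parameters the list `a` and
lower parameters the list `b`; `ascPochhammer` evaluated at `c` is the rising factorial of `c`. -/
def hypergeometricPFQ (a b : List ℝ) (z : ℝ) : ℝ :=
  ∑' n : ℕ, (a.map (fun c => (ascPochhammer ℝ n).eval c)).prod /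
    (b.map (fun c => (ascPochhammer ℝ n).eval c)).prod * z ^ n / (n ! : ℝ)

/-! ### Weighted Sobolev spaces on the radial interval -/

/-- The measure `r dr` on `(0, 1)`. -/
def radialMeasure : Measure ℝ :=
  (volume.restrict (Ioo (0 : ℝ) 1)).withDensity (fun r => ENNReal.ofReal r)

/-- `v` is the weak (distributional) derivative of `u` on `(0, 1)`. -/
def HasWeakDeriv (u v : ℝ → ℝ) : Prop :=
  ∀ η : ℝ → ℝ, ContDiff ℝ ∞ η → HasCompactSupport η → tsupport η ⊆ Ioo (0 : ℝ) 1 →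
    ∫ r in Ioo (0 : ℝ) 1, u r * deriv η r = -∫ r in Ioo (0 : ℝ) 1, v r * η r

/-- `u` belongs to the Sobolev space `H¹₁(0, 1)` with weight `r`, and `u'` is its weak
derivative: both are square integrable with respect to `r dr`. -/
structure MemH11 (u u' : ℝ → ℝ) : Prop where
  memLp : MemLp u 2 radialMeasure
  memLp_deriv : MemLp u' 2 radialMeasure
  weakDeriv : HasWeakDeriv u u'

/-- `u` vanishes at `r = 1`, in the sense of traces: it has a representative which is continuous
on `(0, 1]` and is zero at `1`. -/
def VanishesAtRim (u : ℝ → ℝ) : Prop :=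
  ∃ w : ℝ → ℝ, ContinuousOn w (Ioc 0 1) ∧ u =ᵐ[radialMeasure] w ∧ w 1 = 0

/-- The trial space for `m = 0`: pairs `(ψ, ζ)` in `H¹₁(0, 1)`, with weak derivatives `ψ'`, `ζ'`,
where `ζ` vanishes at the rim and has zero mean with respect to `r dr`. -/
structure IsTrialPair (ψ ψ' ζ ζ' : ℝ → ℝ) : Prop where
  potential : MemH11 ψ ψ'
  height : MemH11 ζ ζ'
  pinned : VanishesAtRim ζ
  mean_zero : ∫ r, ζ r ∂radialMeasure = 0

/-! ### Shape functions and the fundamental frequency -/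

/-- Continuous and piecewise continuously differentiable functions on `[a, b]`: away from a
finite set `s` of break points, `f` is `C¹` on every closed subinterval whose interior
contains no break point (one-sided derivatives at the end points). -/
def IsPC1On (f : ℝ → ℝ) (a b : ℝ) : Prop :=
  ContinuousOn f (Icc a b) ∧
    ∃ s : Finset ℝ, ∀ c d : ℝ, a ≤ c → c < d → d ≤ b → Disjoint (Ioo c d) (s : Set ℝ) →
      ContDiffOn ℝ 1 f (Icc c d)

/-- The class of admissible shape functions of volume `V`; the last condition is
`∫₀¹ h r dr = V / 2π`. -/
def shapeClass (V : ℝ) : Set (ℝ → ℝ) :=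
  {h | IsPC1On h 0 1 ∧ (∀ r ∈ Icc (0 : ℝ) 1, 0 ≤ h r) ∧
    ∫ r, h r ∂radialMeasure = V / (2 * Real.pi)}

/-- The energy `E₀(h; ψ, ζ)` for Bond number `B`, as a function of `ψ'`, `ζ` and `ζ'`. -/
def energy (B : ℝ) (h ψ' ζ ζ' : ℝ → ℝ) : ℝ :=
  1 / 2 * ∫ r, h r * ψ' r ^ 2 ∂radialMeasure +
    1 / 2 * ∫ r, (ζ r ^ 2 + 1 / B * ζ' r ^ 2) ∂radialMeasure

/-- The fundamental shallow sloshing frequency `Ω_{0,1}(h)` for Bond number `B`: the infimum of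
the energy over all trial pairs with `∫₀¹ ψ ζ r dr = 1`. -/
def fundamentalFrequency (B : ℝ) (h : ℝ → ℝ) : ℝ :=
  sInf {e : ℝ | ∃ ψ ψ' ζ ζ' : ℝ → ℝ, IsTrialPair ψ ψ' ζ ζ' ∧
    ∫ r, ψ r * ζ r ∂radialMeasure = 1 ∧ e = energy B h ψ' ζ ζ'}

/-- `λ_{0,1}(h) = Ω_{0,1}(h)²`. -/
def fundamentalEigenvalue (B : ℝ) (h : ℝ → ℝ) : ℝ :=
  fundamentalFrequency B h ^ 2

/-! ### The explicit constants and the explicit profile -/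

/-- `Υ(κ) = I₁(κ) L₀(κ) - I₀(κ) L₁(κ)`. -/
def upsilon (κ : ℝ) : ℝ :=
  besselI 1 κ * struveL 0 κ - besselI 0 κ * struveL 1 κ

/-- The constant `d₀`. -/
def dZero (B : ℝ) : ℝ :=
  (3 * Real.pi * upsilon √B + 2 * B * besselI 0 √B - 6 * √B * besselI 1 √B) /
    (3 * B * besselI 2 √B)

/-- The bound `λ*_{0,1}`; here `√B ^ 3` is `B^{3/2}`. -/
def lambdaStar (B V : ℝ) : ℝ :=
  18 * V / Real.pi *
    (6 * dZero B - 3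
      + 18 * (1 - dZero B) * Real.pi * upsilon √B / (B * besselI 0 √B)
      + 3 * hypergeometricPFQ [1, 2] [3 / 2, 5 / 2, 3] (B / 4)
      - 9 * Real.pi ^ 2 * struveL 0 √B * upsilon √B / (√B ^ 3 * besselI 0 √B))⁻¹

/-- The profile `h*_0`. -/
def optimalShape (B V r : ℝ) : ℝ :=
  lambdaStar B V / 3 * (3 * dZero B * r / 2 - r ^ 2)
    + lambdaStar B V * (1 - dZero B) * besselI 1 (√B * r) / (√B * besselI 0 √B)
    + lambdaStar B V * Real.pi / (2 * B) *
      (struveL 1 (√B * r) - struveL 0 √B * besselI 1 (√B * r) / besselI 0 √B)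

end Sloshing

end

/-!
Write `∫ F` for `∫₀¹ F r dr`. By scaling `ψ` against `ζ`, the eigenvalue of a shape `h` is the infimum
of `∫ h ψ'² * ∫ (ζ² + ζ'² / B)` over the trial pairs with `∫ ψ ζ = 1`.

*Upper bound.* If `ψ` is a multiple of `r`, the first factor depends on `h` only through its volume.
Taking for `ζ` the optimal height `-p` for this potential gives a bound `V / (2 π M)` valid for all
shapes, and the Euler-Lagrange equation in `ψ` shows which shape should attain it: a multiple of the
function `U` with `(r U)' = r p`, and `M = ∫ U`. The system for `U`, `p` and `g = p'` is
`IsReducedProfile`; it is solved by modified Bessel and Struve functions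
(`isReducedProfile_reducedShape`), and `36 M` is the bracket in the definition of `lambdaStar`
(`mass_reducedShape`).

*Positivity.* With `q = -r³ (U / r)'` (`flux`) one has `q' = -r² g` and
`(q' / r³)' = B (q / r³ - 1 / 3)`, while `q` vanishes at both ends. The maximum principle gives
`q ≥ 0`, so `U / r` decreases to its value `0` at `r = 1`, and `U ≥ 0`.

*Lower bound for the shape `U`.* Put `Z = ∫₀ʳ ζ s ds` and `Q = r² ζ - 2 Z`. Then
`Q' = r² ζ'`, so that up to boundary terms `∫ (ζ² + ζ'² / B)` is `∫₀¹ (Q² + Q'² / B) r⁻³ dr`. Since `q`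
is a positive solution of the equation above, Jacobi's substitution bounds this from below by
`∫₀¹ Q² / (3 q) dr`. As `(Z / r²)' = Q / r³` and `(U / r)' = -q / r³`, an inequality of Hardy type
bounds this in turn by `∫₀¹ Z² / (r U) dr`, which controls `∫ ψ ζ = -∫₀¹ ψ' Z dr` together with
`∫ U ψ'²`. All steps are completions of squares, and they combine into a single pointwise inequality
with a total derivative (`pointwise_energy_inequality`). To keep the boundary terms finite, `q` and
`U` are replaced by `q + ε r⁴` and `U + ε (r - r³ / 2)`, which preserve the inequalities. Functions
in `H¹₁` are handled through their absolutely continuous representatives, which exist by the lemma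
of du Bois-Reymond (`HasWeakDeriv.exists_ae_eq_primitive`).

*Failure of convexity.* `U` is nonnegative and `U = U' = 0` at `r = 1`; if `-U` were convex, it would
lie above this tangent, and `U` would vanish.
-/

namespace Sloshing

open Filter Topology

/-! ### Power series of Bessel and Struve type -/

/-- The series `∑ c k (x / 2) ^ (2 k + n)`, the common shape of the series of `I_n` and `L_n`. -/
noncomputable def stepTwoSeries (c : ℕ → ℝ) (n : ℕ) (x : ℝ) : ℝ :=
  ∑' k : ℕ, c k * (x / 2) ^ (2 * k + n)

/-- The coefficients `c` are those of an entire power series. -/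
def EntireCoeff (c : ℕ → ℝ) : Prop :=
  ∀ R : ℝ, 0 ≤ R → Summable fun k => |c k| * R ^ k

lemma EntireCoeff.of_le_factorial {c : ℕ → ℝ} {C : ℝ} (h : ∀ k, |c k| ≤ C / (k ! : ℝ)) :
    EntireCoeff c := by
  intro R hR
  refine Summable.of_nonneg_of_le (fun k => by positivity) (fun k => ?_)
    ((Real.summable_pow_div_factorial R).mul_left C)
  calc |c k| * R ^ k ≤ C / (k ! : ℝ) * R ^ k := by gcongr; exact h k
    _ = C * (R ^ k / (k ! : ℝ)) := by ring

lemma EntireCoeff.mul_linear {c : ℕ → ℝ} (h : EntireCoeff c) (n : ℕ) :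
    EntireCoeff fun k => c k * ((2 * k + n : ℝ) / 2) := by
  intro R hR
  refine Summable.of_nonneg_of_le (fun k => by positivity) (fun k => ?_)
    ((h (2 * R) (by positivity)).mul_left (1 + n : ℝ))
  have h1 : (k : ℝ) ≤ 2 ^ k := by exact_mod_cast Nat.lt_two_pow_self.le
  have h2 : (1 : ℝ) ≤ 2 ^ k := one_le_pow₀ (by norm_num)
  have h3 : (2 * k + n : ℝ) / 2 ≤ (1 + n) * 2 ^ k := by
    nlinarith [mul_le_mul_of_nonneg_left h2 (Nat.cast_nonneg (α := ℝ) n),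
      Nat.cast_nonneg (α := ℝ) n]
  have h4 : (0 : ℝ) ≤ (2 * k + n : ℝ) / 2 := by positivity
  rw [abs_mul, abs_of_nonneg h4, mul_pow]
  calc |c k| * ((2 * k + n : ℝ) / 2) * R ^ k
      ≤ |c k| * ((1 + n) * 2 ^ k) * R ^ k := by gcongr
    _ = (1 + n) * (|c k| * (2 ^ k * R ^ k)) := by ring

lemma EntireCoeff.summable_stepTwo {c : ℕ → ℝ} (h : EntireCoeff c) (n : ℕ) (x : ℝ) :
    Summable fun k => c k * (x / 2) ^ (2 * k + n) := by
  refine Summable.of_norm ?_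
  refine ((h ((x / 2) ^ 2) (sq_nonneg _)).mul_left (|x / 2| ^ n)).congr (fun k => ?_)
  rw [Real.norm_eq_abs, abs_mul, abs_pow, pow_add, pow_mul, sq_abs]
  ring

lemma hasDerivAt_stepTwoSeries {c : ℕ → ℝ} (h : EntireCoeff c) (n : ℕ) (x : ℝ) :
    HasDerivAt (stepTwoSeries c n)
      (∑' k : ℕ, c k * ((2 * k + n : ℝ) / 2) * (x / 2) ^ (2 * k + n - 1)) x := by
  set R : ℝ := |x| + 2 with hR
  have hR2 : 1 ≤ R / 2 := by rw [hR]; linarith [abs_nonneg x]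
  have hbd : Summable fun k : ℕ =>
      |c k * ((2 * k + n : ℝ) / 2)| * ((R / 2) ^ 2) ^ k * (R / 2) ^ n :=
    (h.mul_linear n ((R / 2) ^ 2) (sq_nonneg _)).mul_right _
  refine hasDerivAt_tsum_of_isPreconnected (t := Metric.ball 0 R) (y₀ := 0) hbd
    Metric.isOpen_ball (convex_ball 0 R).isPreconnected
    (g := fun k y => c k * (y / 2) ^ (2 * k + n))
    (g' := fun k y => c k * ((2 * k + n : ℝ) / 2) * (y / 2) ^ (2 * k + n - 1))
    ?_ ?_ ?_ ?_ ?_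
  · intro k y _
    have := (((hasDerivAt_id y).div_const 2).pow (2 * k + n)).const_mul (c k)
    refine this.congr_deriv ?_
    push_cast
    simp only [id]
    ring
  · intro k y hy
    have hy' : |y| < R := by simpa using hy
    rw [Real.norm_eq_abs, abs_mul, abs_pow, mul_assoc, ← pow_mul, ← pow_add]
    gcongr
    calc |y / 2| ^ (2 * k + n - 1) ≤ (R / 2) ^ (2 * k + n - 1) := by
          gcongr
          rw [abs_div, abs_two]; linarith
      _ ≤ (R / 2) ^ (2 * k + n) := pow_le_pow_right₀ hR2 (Nat.sub_le _ _)
  · simp [hR]; positivity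
  · exact h.summable_stepTwo n 0
  · simp [hR]

lemma continuous_stepTwoSeries {c : ℕ → ℝ} (h : EntireCoeff c) (n : ℕ) :
    Continuous (stepTwoSeries c n) :=
  continuous_iff_continuousAt.2 fun x => (hasDerivAt_stepTwoSeries h n x).continuousAt

lemma contDiff_stepTwoSeries {c : ℕ → ℝ} (h : EntireCoeff c) (n : ℕ) :
    ContDiff ℝ 1 (stepTwoSeries c (n + 1)) := by
  rw [contDiff_one_iff_deriv]
  refine ⟨fun x => (hasDerivAt_stepTwoSeries h (n + 1) x).differentiableAt, ?_⟩
  have : deriv (stepTwoSeries c (n + 1)) =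
      stepTwoSeries (fun k => c k * ((2 * k + (n + 1 : ℕ) : ℝ) / 2)) n := by
    ext x
    rw [(hasDerivAt_stepTwoSeries h (n + 1) x).deriv]
    rfl
  rw [this]
  exact continuous_stepTwoSeries (h.mul_linear (n + 1)) n

lemma stepTwoSeries_zero {c : ℕ → ℝ} (n : ℕ) : stepTwoSeries c (n + 1) 0 = 0 := by
  simp [stepTwoSeries]

/-! ### Modified Bessel and Struve functions -/

/-- Coefficients of `I_n`. -/
noncomputable def besselCoeff (n k : ℕ) : ℝ := 1 / ((k ! : ℝ) * ((k + n)! : ℝ))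

/-- Coefficients of `L_n`. -/
noncomputable def struveCoeff (n k : ℕ) : ℝ :=
  1 / (Real.Gamma ((k : ℝ) + 3 / 2) * Real.Gamma ((k : ℝ) + (n : ℝ) + 3 / 2))

lemma besselI_eq (n : ℕ) : besselI n = stepTwoSeries (besselCoeff n) n := by
  ext x
  exact tsum_congr fun k => by rw [besselCoeff]; ring

lemma struveL_eq (n : ℕ) : struveL n = stepTwoSeries (struveCoeff n) (n + 1) := by
  ext x
  exact tsum_congr fun k => by rw [struveCoeff, ← add_assoc]; ring

lemma entireCoeff_bessel (n : ℕ) : EntireCoeff (besselCoeff n) := by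
  refine .of_le_factorial (C := 1) fun k => ?_
  have h1 : (0 : ℝ) < k ! := by exact_mod_cast k.factorial_pos
  have h2 : (1 : ℝ) ≤ (k + n)! := by exact_mod_cast Nat.factorial_pos _
  rw [besselCoeff, abs_of_nonneg (by positivity)]
  gcongr
  nlinarith

lemma factorial_mul_Gamma_le (k : ℕ) :
    (k ! : ℝ) * Real.Gamma (3 / 2) ≤ Real.Gamma ((k : ℝ) + 3 / 2) := by
  induction k with
  | zero => simp
  | succ k ih =>
    have e : ((k + 1 : ℕ) : ℝ) + 3 / 2 = ((k : ℝ) + 3 / 2) + 1 := by push_cast; ring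
    rw [e, Real.Gamma_add_one (by positivity), Nat.factorial_succ]
    have hG : 0 < Real.Gamma ((k : ℝ) + 3 / 2) := Real.Gamma_pos_of_pos (by positivity)
    push_cast
    nlinarith [Nat.cast_nonneg (α := ℝ) k]

lemma entireCoeff_struve (n : ℕ) : EntireCoeff (struveCoeff n) := by
  have hG : 0 < Real.Gamma (3 / 2) := Real.Gamma_pos_of_pos (by norm_num)
  refine .of_le_factorial (C := 1 / (Real.Gamma (3 / 2) * Real.Gamma (3 / 2))) fun k => ?_
  have h1 : (0 : ℝ) < k ! := by exact_mod_cast k.factorial_pos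
  have h2 : (1 : ℝ) ≤ (k + n)! := by exact_mod_cast Nat.factorial_pos _
  have h3 := factorial_mul_Gamma_le k
  have h4 : Real.Gamma (3 / 2) ≤ Real.Gamma ((k : ℝ) + n + 3 / 2) := by
    have := factorial_mul_Gamma_le (k + n)
    push_cast at this
    nlinarith
  have h5 : 0 < Real.Gamma ((k : ℝ) + 3 / 2) := Real.Gamma_pos_of_pos (by positivity)
  have h6 : 0 < Real.Gamma ((k : ℝ) + n + 3 / 2) := Real.Gamma_pos_of_pos (by positivity)
  rw [struveCoeff, abs_of_nonneg (by positivity), div_div]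
  refine one_div_le_one_div_of_le (by positivity) ?_
  calc Real.Gamma (3 / 2) * Real.Gamma (3 / 2) * k !
      = (k ! * Real.Gamma (3 / 2)) * Real.Gamma (3 / 2) := by ring
    _ ≤ _ := by gcongr

lemma Gamma_three_halves : Real.Gamma (3 / 2) = √Real.pi / 2 := by
  rw [show (3 / 2 : ℝ) = 1 / 2 + 1 by norm_num, Real.Gamma_add_one (by norm_num),
    Real.Gamma_one_half_eq]
  ring

lemma hasDerivAt_besselI_zero (x : ℝ) : HasDerivAt (besselI 0) (besselI 1 x) x := by
  rw [besselI_eq 0, besselI_eq 1]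
  refine (hasDerivAt_stepTwoSeries (entireCoeff_bessel 0) 0 x).congr_deriv ?_
  have hs : Summable fun k : ℕ =>
      besselCoeff 0 k * ((2 * k + (0 : ℕ) : ℝ) / 2) * (x / 2) ^ (2 * k + 0 - 1) := by
    refine (summable_nat_add_iff 1).1 ?_
    refine ((entireCoeff_bessel 1).summable_stepTwo 1 x).congr fun k => ?_
    simp only [besselCoeff, Nat.factorial_succ]
    have h1 : (k ! : ℝ) ≠ 0 := by exact_mod_cast k.factorial_ne_zero
    have e : 2 * (k + 1) + 0 - 1 = 2 * k + 1 := by omega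
    rw [e]
    push_cast
    field_simp
    simp only [add_zero]
    ring
  rw [hs.tsum_eq_zero_add]
  simp only [Nat.cast_zero, mul_zero, add_zero, zero_div, zero_mul, zero_add]
  refine tsum_congr fun k => ?_
  simp only [besselCoeff, add_zero, Nat.factorial_succ]
  have h1 : (k ! : ℝ) ≠ 0 := by exact_mod_cast k.factorial_ne_zero
  have e : 2 * (k + 1) - 1 = 2 * k + 1 := by omega
  rw [e]
  push_cast
  field_simp

lemma hasDerivAt_mul_besselI_one (x : ℝ) :
    HasDerivAt (fun x => x * besselI 1 x) (x * besselI 0 x) x := by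
  have e : (fun x => x * besselI 1 x) =
      fun x => 2 * stepTwoSeries (besselCoeff 1) 2 x := by
    ext x
    rw [besselI_eq, stepTwoSeries, stepTwoSeries, ← tsum_mul_left, ← tsum_mul_left]
    exact tsum_congr fun k => by ring
  rw [e]
  refine ((hasDerivAt_stepTwoSeries (entireCoeff_bessel 1) 2 x).const_mul 2).congr_deriv ?_
  rw [besselI_eq, stepTwoSeries, ← tsum_mul_left, ← tsum_mul_left]
  refine tsum_congr fun k => ?_
  simp only [besselCoeff, add_zero, Nat.factorial_succ]
  have h1 : (k ! : ℝ) ≠ 0 := by exact_mod_cast k.factorial_ne_zero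
  have e : 2 * k + 2 - 1 = 2 * k + 1 := by omega
  rw [e, pow_succ]
  push_cast
  field_simp

lemma hasDerivAt_struveL_zero (x : ℝ) :
    HasDerivAt (struveL 0) (2 / Real.pi + struveL 1 x) x := by
  rw [struveL_eq 0, struveL_eq 1]
  refine (hasDerivAt_stepTwoSeries (entireCoeff_struve 0) 1 x).congr_deriv ?_
  have hterm : ∀ k : ℕ, struveCoeff 0 (k + 1) * ((2 * (k + 1 : ℕ) + (1 : ℕ) : ℝ) / 2) *
      (x / 2) ^ (2 * (k + 1) + 1 - 1) = struveCoeff 1 k * (x / 2) ^ (2 * k + (1 + 1)) := by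
    intro k
    have e : 2 * (k + 1) + 1 - 1 = 2 * k + (1 + 1) := by omega
    have e2 : ((k + 1 : ℕ) : ℝ) + 3 / 2 = ((k : ℝ) + 3 / 2) + 1 := by push_cast; ring
    have e3 : (k : ℝ) + (1 : ℕ) + 3 / 2 = ((k : ℝ) + 3 / 2) + 1 := by push_cast; ring
    have h1 : Real.Gamma ((k : ℝ) + 3 / 2) ≠ 0 :=
      (Real.Gamma_pos_of_pos (by positivity)).ne'
    simp only [struveCoeff]
    rw [e, Nat.cast_zero, add_zero, e2, e3, Real.Gamma_add_one (by positivity)]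
    push_cast
    have h2 : (2 * (k : ℝ) + 3) ≠ 0 := by positivity
    field_simp
    ring
  have hs : Summable fun k : ℕ =>
      struveCoeff 0 k * ((2 * k + (1 : ℕ) : ℝ) / 2) * (x / 2) ^ (2 * k + 1 - 1) := by
    refine (summable_nat_add_iff 1).1 ?_
    exact ((entireCoeff_struve 1).summable_stepTwo (1 + 1) x).congr fun k => (hterm k).symm
  rw [hs.tsum_eq_zero_add]
  congr 1
  · simp only [struveCoeff, Nat.cast_zero, zero_add, Gamma_three_halves, mul_zero]
    have : √Real.pi * √Real.pi = Real.pi := Real.mul_self_sqrt Real.pi_pos.le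
    have h0 : √Real.pi ≠ 0 := by positivity
    rw [← this]
    field_simp
    norm_num
  · exact tsum_congr hterm

lemma hasDerivAt_mul_struveL_one (x : ℝ) :
    HasDerivAt (fun x => x * struveL 1 x) (x * struveL 0 x) x := by
  have e : (fun x => x * struveL 1 x) =
      fun x => 2 * stepTwoSeries (struveCoeff 1) 3 x := by
    ext x
    rw [struveL_eq, stepTwoSeries, stepTwoSeries, ← tsum_mul_left, ← tsum_mul_left]
    exact tsum_congr fun k => by ring
  rw [e]
  refine ((hasDerivAt_stepTwoSeries (entireCoeff_struve 1) 3 x).const_mul 2).congr_deriv ?_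
  rw [struveL_eq, stepTwoSeries, ← tsum_mul_left, ← tsum_mul_left]
  refine tsum_congr fun k => ?_
  have h1 : Real.Gamma ((k : ℝ) + 3 / 2) ≠ 0 :=
    (Real.Gamma_pos_of_pos (by positivity)).ne'
  have e : 2 * k + 3 - 1 = (2 * k + (0 + 1)) + 1 := by omega
  have e3 : (k : ℝ) + (1 : ℕ) + 3 / 2 = ((k : ℝ) + 3 / 2) + 1 := by push_cast; ring
  simp only [struveCoeff]
  rw [e, pow_succ, e3, Real.Gamma_add_one (by positivity), Nat.cast_zero, add_zero]
  push_cast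
  have h2 : (2 * (k : ℝ) + 3) ≠ 0 := by positivity
  field_simp

lemma contDiff_besselI_one : ContDiff ℝ 1 (besselI 1) := by
  rw [besselI_eq]; exact contDiff_stepTwoSeries (entireCoeff_bessel 1) 0

lemma contDiff_struveL_one : ContDiff ℝ 1 (struveL 1) := by
  rw [struveL_eq]; exact contDiff_stepTwoSeries (entireCoeff_struve 1) 1

lemma besselI_pos (n : ℕ) {x : ℝ} (hx : 0 < x) : 0 < besselI n x := by
  rw [besselI_eq]
  refine ((entireCoeff_bessel n).summable_stepTwo n x).tsum_pos (fun k => ?_) 0 ?_ <;>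
  · simp only [besselCoeff]; positivity

lemma mul_besselI_two (x : ℝ) : x * besselI 2 x = x * besselI 0 x - 2 * besselI 1 x := by
  have h0 := ((entireCoeff_bessel 0).summable_stepTwo 0 x).mul_left x
  have h1 := ((entireCoeff_bessel 1).summable_stepTwo 1 x).mul_left 2
  simp only [besselI_eq, stepTwoSeries]
  rw [← tsum_mul_left, ← tsum_mul_left, ← tsum_mul_left, ← h0.tsum_sub h1, (h0.sub h1).tsum_eq_zero_add]
  have z : x * (besselCoeff 0 0 * (x / 2) ^ (2 * 0 + 0)) -
      2 * (besselCoeff 1 0 * (x / 2) ^ (2 * 0 + 1)) = 0 := by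
    simp [besselCoeff]; ring
  rw [z, zero_add]
  refine tsum_congr fun k => ?_
  have h1 : (k ! : ℝ) ≠ 0 := by exact_mod_cast k.factorial_ne_zero
  simp only [besselCoeff, add_zero, Nat.factorial_succ, show k + 2 = k + 1 + 1 from rfl]
  push_cast
  field_simp
  ring

lemma hasDerivAt_mul_upsilon (x : ℝ) :
    HasDerivAt (fun x => x * upsilon x) (2 / Real.pi * (x * besselI 1 x)) x := by
  have h := (((hasDerivAt_mul_besselI_one x).mul (hasDerivAt_struveL_zero x)).sub
    ((hasDerivAt_besselI_zero x).mul (hasDerivAt_mul_struveL_one x)))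
  have e : (fun x => x * upsilon x) = (fun x => x * besselI 1 x) * struveL 0 -
      besselI 0 * (fun x => x * struveL 1 x) := by
    ext x; simp [upsilon]; ring
  rw [e]
  exact h.congr_deriv (by ring)

lemma integral_mul_besselI_one {κ : ℝ} (hκ : κ ≠ 0) :
    ∫ r in (0 : ℝ)..1, r * besselI 1 (κ * r) = Real.pi / (2 * κ) * upsilon κ := by
  have hd : ∀ r ∈ uIcc (0 : ℝ) 1,
      HasDerivAt (fun r => Real.pi / (2 * κ ^ 2) * ((κ * r) * upsilon (κ * r)))
        (r * besselI 1 (κ * r)) r := by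
    intro r _
    have h1 : HasDerivAt (fun r : ℝ => κ * r) κ r := by
      simpa using (hasDerivAt_id r).const_mul κ
    have h2 := ((hasDerivAt_mul_upsilon (κ * r)).comp r h1).const_mul (Real.pi / (2 * κ ^ 2))
    refine h2.congr_deriv ?_
    field_simp
  have hc : Continuous fun r => r * besselI 1 (κ * r) :=
    continuous_id.mul (contDiff_besselI_one.continuous.comp (continuous_const.mul continuous_id))
  rw [intervalIntegral.integral_eq_sub_of_hasDerivAt hd (hc.intervalIntegrable _ _)]
  simp only [mul_one, mul_zero, zero_mul, sub_zero]
  field_simp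

lemma Gamma_add_natCast {a : ℝ} (ha : 0 < a) (k : ℕ) :
    Real.Gamma (k + a) = (ascPochhammer ℝ k).eval a * Real.Gamma a := by
  induction k with
  | zero => simp
  | succ k ih =>
    rw [ascPochhammer_succ_eval, show ((k + 1 : ℕ) : ℝ) + a = (k + a) + 1 by push_cast; ring,
      Real.Gamma_add_one (by positivity), ih]
    ring

lemma integral_mul_struveL_one {κ : ℝ} (hκ : κ ≠ 0) :
    ∫ r in (0 : ℝ)..1, r * struveL 1 (κ * r) =
      κ ^ 2 / (6 * Real.pi) * hypergeometricPFQ [1, 2] [3 / 2, 5 / 2, 3] (κ ^ 2 / 4) := by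
  set c : ℕ → ℝ := fun k => struveCoeff 1 k / (k + 2) with hc
  have hcE : EntireCoeff c := by
    intro R hR
    refine Summable.of_nonneg_of_le (fun k => by positivity) (fun k => ?_)
      (entireCoeff_struve 1 R hR)
    refine mul_le_mul_of_nonneg_right ?_ (by positivity)
    simp only [hc]
    rw [abs_div, abs_of_nonneg (by positivity : (0 : ℝ) ≤ k + 2)]
    exact div_le_self (abs_nonneg _) (by linarith [Nat.cast_nonneg (α := ℝ) k])
  have hd : ∀ r ∈ uIcc (0 : ℝ) 1,
      HasDerivAt (fun r => 2 / κ ^ 2 * stepTwoSeries c 4 (κ * r))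
        (r * struveL 1 (κ * r)) r := by
    intro r _
    have h1 : HasDerivAt (fun r : ℝ => κ * r) κ r := by
      simpa using (hasDerivAt_id r).const_mul κ
    have h2 := ((hasDerivAt_stepTwoSeries hcE 4 (κ * r)).comp r h1).const_mul (2 / κ ^ 2)
    refine h2.congr_deriv ?_
    have h3 : ∑' k : ℕ, c k * ((2 * k + (4 : ℕ) : ℝ) / 2) * (κ * r / 2) ^ (2 * k + 4 - 1) =
        κ * r / 2 * struveL 1 (κ * r) := by
      rw [struveL_eq, stepTwoSeries, ← tsum_mul_left]
      refine tsum_congr fun k => ?_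
      rw [hc, show 2 * k + 4 - 1 = (2 * k + (1 + 1)) + 1 by omega, pow_succ]
      have : (k : ℝ) + 2 ≠ 0 := by positivity
      push_cast
      field_simp
      ring
    rw [h3]
    field_simp
  have hcont : Continuous fun r => r * struveL 1 (κ * r) :=
    continuous_id.mul (contDiff_struveL_one.continuous.comp (continuous_const.mul continuous_id))
  rw [intervalIntegral.integral_eq_sub_of_hasDerivAt hd (hcont.intervalIntegrable _ _)]
  rw [mul_zero, stepTwoSeries_zero, mul_zero, sub_zero, mul_one, hypergeometricPFQ, stepTwoSeries,
    ← tsum_mul_left, ← tsum_mul_left]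
  refine tsum_congr fun k => ?_
  have hG : Real.Gamma (5 / 2) = 3 / 2 * (√Real.pi / 2) := by
    rw [show (5 / 2 : ℝ) = 3 / 2 + 1 by norm_num, Real.Gamma_add_one (by norm_num),
      Gamma_three_halves]
  have h1 : (ascPochhammer ℝ k).eval 1 = (k ! : ℝ) := by simp
  -- both sides equal `(2)ₖ₊₁`
  have h2 : (ascPochhammer ℝ k).eval 3 * 2 = (ascPochhammer ℝ k).eval 2 * (k + 2) := by
    have e1 := Gamma_add_natCast (a := 2) two_pos k
    have e2 := Gamma_add_natCast (a := 3) three_pos k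
    have e3 : Real.Gamma (k + 3) = (k + 2) * Real.Gamma (k + 2) := by
      rw [← Real.Gamma_add_one (by positivity)]; ring_nf
    have g3 : Real.Gamma 3 = 2 * Real.Gamma 2 := by
      rw [← Real.Gamma_add_one (by norm_num)]; norm_num
    have g2 : 0 < Real.Gamma 2 := Real.Gamma_pos_of_pos two_pos
    rw [e3, e1, g3] at e2
    refine mul_right_cancel₀ g2.ne' ?_
    linarith
  have p3 : 0 < (ascPochhammer ℝ k).eval (3 : ℝ) := ascPochhammer_pos _ _ (by norm_num)
  have p32 : 0 < (ascPochhammer ℝ k).eval (3 / 2 : ℝ) := ascPochhammer_pos _ _ (by norm_num)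
  have p52 : 0 < (ascPochhammer ℝ k).eval (5 / 2 : ℝ) := ascPochhammer_pos _ _ (by norm_num)
  have hk : (0 : ℝ) < k ! := by exact_mod_cast k.factorial_pos
  have e5 : (k : ℝ) + (1 : ℕ) + 3 / 2 = k + 5 / 2 := by push_cast; ring
  simp only [hc, struveCoeff, List.map_cons, List.map_nil, List.prod_cons, List.prod_nil, mul_one]
  rw [e5, Gamma_add_natCast (by norm_num) k, Gamma_add_natCast (by norm_num) k, hG,
    Gamma_three_halves, h1]
  have hpi : √Real.pi * √Real.pi = Real.pi := Real.mul_self_sqrt Real.pi_pos.le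
  have hpi0 : √Real.pi ≠ 0 := by positivity
  have hk2 : (k : ℝ) + 2 ≠ 0 := by positivity
  have hq : (κ / 2) ^ (2 * k + 4) = (κ ^ 2 / 4) ^ k * (κ ^ 4 / 16) := by
    rw [pow_add, pow_mul]; ring
  have h3 : (ascPochhammer ℝ k).eval (2 : ℝ) = (ascPochhammer ℝ k).eval 3 * 2 / (k + 2) := by
    rw [h2]; field_simp
  rw [hq, h3]
  generalize √Real.pi = s at hpi hpi0 ⊢
  rw [← hpi]
  field_simp
  ring

/-! ### The reduced optimal profile -/

/-- The Euler-Lagrange system of the optimal container, in first order form. Here `U` is the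
optimal shape divided by the optimal eigenvalue, `-p` is the surface height that goes with the
potential `r`, and `g = p'`. The equations say that `-p - (1 / B) Δ (-p) = r - d` with a Lagrange
multiplier `d` for the zero mean, and that `(r U)' = r p`, integrated once; `p 1 = 0` is the pinned
contact line and `U 1 = 0` the zero mean of `p`. The equation for `g` is stated for `r * g r`, which
avoids the singular point `r = 0`. -/
structure IsReducedProfile (B d : ℝ) (U p g : ℝ → ℝ) : Prop where
  eq : ∀ r, U r = d * r / 2 - r ^ 2 / 3 + g r / B
  deriv_p : ∀ r, HasDerivAt p (g r) r
  deriv_mul_g : ∀ r, HasDerivAt (fun r => r * g r) (B * (r * p r - d * r + r ^ 2)) r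
  contDiff_g : ContDiff ℝ 1 g
  p_one : p 1 = 0
  U_one : U 1 = 0

namespace IsReducedProfile

variable {B d : ℝ} {U p g : ℝ → ℝ}

lemma g_zero (h : IsReducedProfile B d U p g) : g 0 = 0 := by
  have h1 := (hasDerivAt_id (0 : ℝ)).mul
    ((h.contDiff_g.differentiable one_ne_zero) 0).hasDerivAt
  have h2 := h1.unique (h.deriv_mul_g 0)
  simpa using h2

lemma U_zero (h : IsReducedProfile B d U p g) : U 0 = 0 := by
  simp [h.eq, h.g_zero]

lemma contDiff_U (h : IsReducedProfile B d U p g) : ContDiff ℝ 1 U := by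
  have : U = fun r => d * r / 2 - r ^ 2 / 3 + g r / B := funext h.eq
  rw [this]
  have := h.contDiff_g
  fun_prop

lemma continuous_g (h : IsReducedProfile B d U p g) : Continuous g := h.contDiff_g.continuous

lemma continuous_U (h : IsReducedProfile B d U p g) : Continuous U := h.contDiff_U.continuous

lemma continuous_p (h : IsReducedProfile B d U p g) : Continuous p :=
  continuous_iff_continuousAt.2 fun r => (h.deriv_p r).continuousAt

lemma contDiff_p (h : IsReducedProfile B d U p g) : ContDiff ℝ 1 p := by
  rw [contDiff_one_iff_deriv]
  refine ⟨fun r => (h.deriv_p r).differentiableAt, ?_⟩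
  rw [show deriv p = g from funext fun r => (h.deriv_p r).deriv]
  exact h.continuous_g

lemma hasDerivAt_mul_U (h : IsReducedProfile B d U p g) (hB : B ≠ 0) (r : ℝ) :
    HasDerivAt (fun r => r * U r) (r * p r) r := by
  have e : (fun r => r * U r) = fun r => d / 2 * r ^ 2 - 1 / 3 * r ^ 3 + r * g r / B := by
    ext r; rw [h.eq]; ring
  rw [e]
  refine ((((hasDerivAt_pow 2 r).const_mul (d / 2)).sub
    ((hasDerivAt_pow 3 r).const_mul (1 / 3))).add
    ((h.deriv_mul_g r).div_const B)).congr_deriv ?_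
  field_simp
  push_cast
  ring

/-- `r ^ 3` times minus the derivative of `U r / r`. It solves a second order equation which obeys
the maximum principle. -/
def flux (U p : ℝ → ℝ) (r : ℝ) : ℝ := 2 * (r * U r) - r ^ 2 * p r

lemma hasDerivAt_flux (h : IsReducedProfile B d U p g) (hB : B ≠ 0) (r : ℝ) :
    HasDerivAt (flux U p) (-r ^ 2 * g r) r := by
  refine (((h.hasDerivAt_mul_U hB r).const_mul 2).sub
    ((hasDerivAt_pow 2 r).mul (h.deriv_p r))).congr_deriv ?_
  push_cast
  ring

lemma hasDerivAt_g_div (h : IsReducedProfile B d U p g) (hB : B ≠ 0) {r : ℝ} (hr : r ≠ 0) :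
    HasDerivAt (fun r => g r / r) (B * (1 / 3 - flux U p r / r ^ 3)) r := by
  have h1 := (h.deriv_mul_g r).div (hasDerivAt_pow 2 r) (pow_ne_zero 2 hr)
  refine (h1.congr_of_eventuallyEq ?_).congr_deriv ?_
  · filter_upwards [isOpen_ne.mem_nhds hr] with x hx
    have : x ≠ 0 := hx
    simp
    field_simp
  · have := h.eq r
    simp only [flux, this]
    push_cast
    field_simp
    ring

lemma hasDerivAt_U_div (h : IsReducedProfile B d U p g) (hB : B ≠ 0) {r : ℝ} (hr : r ≠ 0) :
    HasDerivAt (fun r => U r / r) (-(flux U p r / r ^ 3)) r := by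
  have h1 := (h.hasDerivAt_mul_U hB r).div (hasDerivAt_pow 2 r) (pow_ne_zero 2 hr)
  refine (h1.congr_of_eventuallyEq ?_).congr_deriv ?_
  · filter_upwards [isOpen_ne.mem_nhds hr] with x hx
    have : x ≠ 0 := hx
    simp
    field_simp
  · simp only [flux]
    push_cast
    field_simp
    ring

lemma flux_zero : flux U p 0 = 0 := by simp [flux]

lemma flux_one (h : IsReducedProfile B d U p g) : flux U p 1 = 0 := by
  simp [flux, h.p_one, h.U_one]

lemma continuous_flux (h : IsReducedProfile B d U p g) : Continuous (flux U p) := by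
  have := h.continuous_p
  have := h.continuous_U
  unfold flux
  fun_prop

/-- The maximum principle: the flux cannot have a negative interior minimum, since it would decrease
just to the right of it. -/
lemma flux_nonneg (h : IsReducedProfile B d U p g) (hB : 0 < B) {r : ℝ} (hr : r ∈ Icc (0 : ℝ) 1) :
    0 ≤ flux U p r := by
  obtain ⟨t, ht, hmin⟩ := isCompact_Icc.exists_isMinOn ⟨r, hr⟩ h.continuous_flux.continuousOn
  by_contra! hneg
  have htneg : flux U p t < 0 := (hmin hr).trans_lt hneg
  have ht0 : 0 < t := lt_of_le_of_ne ht.1 fun e => by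
    rw [← e, flux_zero] at htneg; exact lt_irrefl _ htneg
  have ht1 : t < 1 := lt_of_le_of_ne ht.2 fun e => by
    rw [e, h.flux_one] at htneg; exact lt_irrefl _ htneg
  have hloc : IsLocalMin (flux U p) t := hmin.isLocalMin (Icc_mem_nhds ht0 ht1)
  have hg0 : g t = 0 := by
    have := hloc.hasDerivAt_eq_zero (h.hasDerivAt_flux hB.ne' t)
    simpa [ht0.ne'] using this
  have hpos : 0 < B * (1 / 3 - flux U p t / t ^ 3) := by
    have : flux U p t / t ^ 3 < 0 := div_neg_of_neg_of_pos htneg (by positivity)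
    exact mul_pos hB (by linarith)
  -- `g` is positive just to the right of `t`, so the flux decreases there
  have hev : ∀ᶠ s in nhdsWithin t (Ioi t), 0 < slope (fun r => g r / r) t s :=
    ((hasDerivAt_iff_tendsto_slope.1 (h.hasDerivAt_g_div hB.ne' ht0.ne')).mono_left
      (nhdsWithin_mono t fun s hs => ne_of_gt hs)).eventually (lt_mem_nhds hpos)
  obtain ⟨u, hu, hsub⟩ := (mem_nhdsGT_iff_exists_Ioo_subset' ht1).1 hev
  have hanti : StrictAntiOn (flux U p) (Icc t (min u 1)) := by
    refine strictAntiOn_of_deriv_neg (convex_Icc _ _) h.continuous_flux.continuousOn fun s hs => ?_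
    rw [interior_Icc] at hs
    have hs' : 0 < slope (fun r => g r / r) t s := hsub ⟨hs.1, hs.2.trans_le (min_le_left _ _)⟩
    rw [slope_def_field, hg0, zero_div, sub_zero] at hs'
    have hs0 : 0 < s := ht0.trans hs.1
    have hst : 0 < s - t := sub_pos.2 hs.1
    have hgs : 0 < g s := by
      have := (div_pos_iff_of_pos_right hst).1 hs'
      exact (div_pos_iff_of_pos_right hs0).1 this
    rw [(h.hasDerivAt_flux hB.ne' s).deriv]
    have := mul_pos (pow_pos hs0 2) hgs
    linarith
  have hlt : t < min u 1 := lt_min hu ht1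
  have h1 := hanti (left_mem_Icc.2 hlt.le) (right_mem_Icc.2 hlt.le) hlt
  have h2 : flux U p t ≤ flux U p (min u 1) := hmin ⟨ht0.le.trans hlt.le, min_le_right _ _⟩
  linarith

lemma U_nonneg (h : IsReducedProfile B d U p g) (hB : 0 < B) {r : ℝ} (hr : r ∈ Icc (0 : ℝ) 1) :
    0 ≤ U r := by
  rcases hr.1.eq_or_lt with rfl | hr0
  · rw [h.U_zero]
  have hanti : AntitoneOn (fun r => U r / r) (Icc r 1) := by
    refine antitoneOn_of_deriv_nonpos (convex_Icc _ _) ?_ ?_ ?_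
    · intro s hs
      exact (h.hasDerivAt_U_div hB.ne' (hr0.trans_le hs.1).ne').continuousAt.continuousWithinAt
    · intro s hs
      rw [interior_Icc] at hs
      exact (h.hasDerivAt_U_div hB.ne'
        (hr0.trans hs.1).ne').differentiableAt.differentiableWithinAt
    · intro s hs
      rw [interior_Icc] at hs
      have hs0 := hr0.trans hs.1
      rw [(h.hasDerivAt_U_div hB.ne' hs0.ne').deriv]
      have := h.flux_nonneg hB ⟨hs0.le, hs.2.le⟩
      have := div_nonneg this (pow_pos hs0 3).le
      linarith
  have := hanti (left_mem_Icc.2 hr.2) (right_mem_Icc.2 hr.2) hr.2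
  simp only [h.U_one, zero_div] at this
  exact (by simpa [hr0.ne'] using mul_nonneg this hr0.le)

/-- `∫₀¹ U r dr`. The volume constraint makes `V / (2 π mass U)` the optimal eigenvalue. -/
noncomputable def mass (U : ℝ → ℝ) : ℝ := ∫ r in (0 : ℝ)..1, r * U r

lemma integral_mul_p (h : IsReducedProfile B d U p g) (hB : B ≠ 0) :
    ∫ r in (0 : ℝ)..1, r * p r = 0 := by
  have := h.continuous_p
  rw [intervalIntegral.integral_eq_sub_of_hasDerivAt (fun r _ => h.hasDerivAt_mul_U hB r)
    (Continuous.intervalIntegrable (by fun_prop) _ _)]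
  simp [h.U_one]

lemma integral_sq_mul_p (h : IsReducedProfile B d U p g) (hB : B ≠ 0) :
    ∫ r in (0 : ℝ)..1, r * (r * p r) = -mass U := by
  have := h.continuous_p
  have := intervalIntegral.integral_mul_deriv_eq_deriv_mul (a := (0 : ℝ)) (b := 1)
    (fun r _ => hasDerivAt_id r) (fun r _ => h.hasDerivAt_mul_U hB r)
    (Continuous.intervalIntegrable (by fun_prop) _ _)
    (Continuous.intervalIntegrable (by fun_prop) _ _)
  simpa [h.U_one, mass] using this

lemma integral_energy (h : IsReducedProfile B d U p g) (hB : B ≠ 0) :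
    ∫ r in (0 : ℝ)..1, r * (p r ^ 2 + 1 / B * g r ^ 2) = mass U := by
  have hp := h.continuous_p
  have hg := h.continuous_g
  have h1 := intervalIntegral.integral_mul_deriv_eq_deriv_mul (a := (0 : ℝ)) (b := 1)
    (fun r _ => h.deriv_p r) (fun r _ => h.deriv_mul_g r)
    (hg.intervalIntegrable _ _)
    (Continuous.intervalIntegrable (by fun_prop) _ _)
  have h2 : ∫ r in (0 : ℝ)..1, r * (p r ^ 2 + 1 / B * g r ^ 2) =
      1 / B * (∫ r in (0 : ℝ)..1, p r * (B * (r * p r - d * r + r ^ 2))) +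
      1 / B * (∫ r in (0 : ℝ)..1, g r * (r * g r)) + d * (∫ r in (0 : ℝ)..1, r * p r) -
      ∫ r in (0 : ℝ)..1, r * (r * p r) := by
    rw [← intervalIntegral.integral_const_mul, ← intervalIntegral.integral_const_mul,
      ← intervalIntegral.integral_const_mul, ← intervalIntegral.integral_add,
      ← intervalIntegral.integral_add, ← intervalIntegral.integral_sub]
    · refine intervalIntegral.integral_congr fun r _ => ?_
      field_simp
      ring
    all_goals exact Continuous.intervalIntegrable (by fun_prop) _ _
  rw [h2, h1, h.integral_mul_p hB, h.integral_sq_mul_p hB, h.p_one]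
  simp

lemma mass_pos (h : IsReducedProfile B d U p g) (hB : 0 < B) : 0 < mass U := by
  have hp := h.continuous_p
  have hg := h.continuous_g
  have hU := h.continuous_U
  have hcont : Continuous fun r => r * U r := by fun_prop
  have hnn : ∀ r ∈ Ioc (0 : ℝ) 1, 0 ≤ r * U r := fun r hr =>
    mul_nonneg hr.1.le (h.U_nonneg hB ⟨hr.1.le, hr.2⟩)
  -- otherwise `U` vanishes on `(0, 1)`, hence so do `p` and `g`, against the equation for `U`
  by_contra! hle
  have hU0 : ∀ r ∈ Ioo (0 : ℝ) 1, U r = 0 := by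
    intro r hr
    by_contra hne
    refine absurd hle (not_le.2 ?_)
    refine intervalIntegral.integral_pos zero_lt_one hcont.continuousOn hnn
      ⟨r, ⟨hr.1.le, hr.2.le⟩, mul_pos hr.1 ?_⟩
    exact lt_of_le_of_ne (h.U_nonneg hB ⟨hr.1.le, hr.2.le⟩) (Ne.symm hne)
  have hp0 : ∀ r ∈ Ioo (0 : ℝ) 1, p r = 0 := by
    intro r hr
    have h1 : HasDerivAt (fun r => r * U r) 0 r := by
      refine (hasDerivAt_const r (0 : ℝ)).congr_of_eventuallyEq ?_
      filter_upwards [isOpen_Ioo.mem_nhds hr] with s hs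
      rw [hU0 s hs, mul_zero]
    have := (h.hasDerivAt_mul_U hB.ne' r).unique h1
    exact (mul_eq_zero.1 this).resolve_left hr.1.ne'
  have hg0 : ∀ r ∈ Ioo (0 : ℝ) 1, g r = 0 := by
    intro r hr
    have h1 : HasDerivAt p 0 r := by
      refine (hasDerivAt_const r (0 : ℝ)).congr_of_eventuallyEq ?_
      filter_upwards [isOpen_Ioo.mem_nhds hr] with s hs
      rw [hp0 s hs]
    exact (h.deriv_p r).unique h1
  have e1 := h.eq (1 / 2)
  have e2 := h.eq (1 / 4)
  rw [hU0 _ (by norm_num), hg0 _ (by norm_num)] at e1 e2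
  norm_num at e1 e2
  linarith

lemma hasDerivAt_U_one (h : IsReducedProfile B d U p g) (hB : B ≠ 0) : HasDerivAt U 0 1 := by
  have h1 := (h.contDiff_U.differentiable one_ne_zero 1).hasDerivAt
  have h2 := ((hasDerivAt_id (1 : ℝ)).mul h1).unique (h.hasDerivAt_mul_U hB 1)
  simp only [id, h.U_one, h.p_one] at h2
  have : deriv U 1 = 0 := by linarith
  rwa [this] at h1

/-- The reduced profile is nonnegative and has a double zero at `1`, so it is not concave. -/
lemma not_convexOn_neg (h : IsReducedProfile B d U p g) (hB : 0 < B) :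
    ¬ ConvexOn ℝ (Icc (0 : ℝ) 1) fun r => -U r := by
  intro hc
  have hpos := h.mass_pos hB
  have hle : ∀ r ∈ Icc (0 : ℝ) 1, r * U r ≤ 0 := by
    intro r hr
    rcases hr.2.eq_or_lt with rfl | hr1
    · simp [h.U_one]
    have hd : HasDerivAt (fun r => -U r) 0 1 := by
      simpa using! (h.hasDerivAt_U_one hB.ne').neg
    have := hc.slope_le_of_hasDerivAt hr (right_mem_Icc.2 zero_le_one) hr1 hd
    rw [slope_def_field, h.U_one] at this
    have h1 : 0 < 1 - r := sub_pos.2 hr1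
    rw [div_le_iff₀ h1] at this
    nlinarith [hr.1]
  have : mass U ≤ 0 := by
    have h0 := intervalIntegral.integral_mono_on (μ := volume) zero_le_one
      (Continuous.intervalIntegrable (continuous_id.mul h.continuous_U) _ _)
      (continuous_const.intervalIntegrable _ _) hle
    simpa [mass] using h0
  linarith

end IsReducedProfile

/-! ### The radial measure -/

lemma integral_radialMeasure (F : ℝ → ℝ) :
    ∫ r, F r ∂radialMeasure = ∫ r in (0 : ℝ)..1, r * F r := by
  rw [radialMeasure, integral_withDensity_eq_integral_toReal_smul (by fun_prop) (by simp),
    intervalIntegral.integral_of_le zero_le_one, integral_Ioc_eq_integral_Ioo]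
  refine setIntegral_congr_fun measurableSet_Ioo fun r hr => ?_
  simp [hr.1.le]

lemma integrable_radialMeasure_iff (F : ℝ → ℝ) :
    Integrable F radialMeasure ↔ IntervalIntegrable (fun r => r * F r) volume 0 1 := by
  rw [radialMeasure, integrable_withDensity_iff_integrable_smul' (by fun_prop) (by simp),
    intervalIntegrable_iff_integrableOn_Ioo_of_le zero_le_one]
  refine integrableOn_congr_fun (fun r hr => ?_) measurableSet_Ioo
  simp [hr.1.le]

lemma ae_radialMeasure_iff (P : ℝ → Prop) :
    (∀ᵐ r ∂radialMeasure, P r) ↔ ∀ᵐ r ∂volume.restrict (Ioo (0 : ℝ) 1), P r := by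
  rw [radialMeasure, ae_withDensity_iff (by fun_prop), ae_restrict_iff' measurableSet_Ioo,
    ae_restrict_iff' measurableSet_Ioo]
  refine ⟨fun h => ?_, fun h => ?_⟩ <;> filter_upwards [h] with r hr h1
  · exact hr h1 (by simpa using h1.1)
  · exact fun _ => hr h1

instance : IsFiniteMeasure radialMeasure := by
  have : Integrable (fun _ : ℝ => (1 : ℝ)) radialMeasure := by
    rw [integrable_radialMeasure_iff]
    exact Continuous.intervalIntegrable (by fun_prop) _ _
  simpa [integrable_const_iff] using this

/-- A radially integrable function is integrable away from the origin. -/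
lemma intervalIntegrable_of_radial {F : ℝ → ℝ} (hF : Integrable F radialMeasure) {a b : ℝ}
    (ha : 0 < a) (ha1 : a ≤ 1) (hb : 0 < b) (hb1 : b ≤ 1) : IntervalIntegrable F volume a b := by
  have hsub : uIcc a b ⊆ uIcc 0 1 := uIcc_subset_uIcc (by simp [ha.le, ha1]) (by simp [hb.le, hb1])
  have h1 := ((integrable_radialMeasure_iff F).1 hF).mono_set hsub
  have hpos : ∀ r ∈ uIcc a b, r ≠ 0 := fun r hr => by
    have := hr.1; exact ((lt_min ha hb).trans_le this).ne'
  have h2 := h1.continuousOn_mul (g := fun r => r⁻¹)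
    (continuousOn_id.inv₀ hpos)
  refine h2.congr fun r hr => ?_
  have := hpos r (uIoc_subset_uIcc hr)
  field_simp

/-! ### Weak derivatives and absolutely continuous representatives -/

lemma exists_Icc_of_isCompact_subset {K : Set ℝ} (hK : IsCompact K) (hs : K ⊆ Ioo (0 : ℝ) 1) :
    ∃ a b : ℝ, 0 < a ∧ a < b ∧ b < 1 ∧ K ⊆ Icc a b := by
  have hK' : IsCompact (K ∪ {1 / 3, 2 / 3}) := hK.union (Set.toFinite _).isCompact
  have hs' : K ∪ {1 / 3, 2 / 3} ⊆ Ioo (0 : ℝ) 1 := by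
    refine union_subset hs ?_
    rintro x (rfl | rfl) <;> norm_num
  have hne : (K ∪ {1 / 3, 2 / 3}).Nonempty := ⟨1 / 3, by simp⟩
  obtain ⟨a, ha, ha'⟩ := hK'.exists_isLeast hne
  obtain ⟨b, hb, hb'⟩ := hK'.exists_isGreatest hne
  have h1 : a ≤ 1 / 3 := ha' (by simp)
  have h2 : 2 / 3 ≤ b := hb' (by simp)
  exact ⟨a, b, (hs' ha).1, by linarith, (hs' hb).2,
    fun x hx => ⟨ha' (Or.inl hx), hb' (Or.inl hx)⟩⟩

lemma integrableOn_mul_test {D ξ : ℝ → ℝ}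
    (hD : ∀ a : ℝ, 0 < a → a ≤ 1 → IntervalIntegrable D volume a 1) (hξ : Continuous ξ)
    (hc : HasCompactSupport ξ) (hs : tsupport ξ ⊆ Ioo (0 : ℝ) 1) :
    IntegrableOn (fun r => D r * ξ r) (Ioo 0 1) := by
  obtain ⟨a, b, ha, hab, hb, hK⟩ := exists_Icc_of_isCompact_subset hc hs
  have h1 : IntervalIntegrable (fun r => D r * ξ r) volume a 1 :=
    (hD a ha (hab.trans hb).le).mul_continuousOn hξ.continuousOn
  rw [intervalIntegrable_iff_integrableOn_Ioc_of_le (hab.trans hb).le,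
    ← integrableOn_Icc_iff_integrableOn_Ioc] at h1
  refine h1.of_forall_sdiff_eq_zero measurableSet_Ioo fun r hr => ?_
  have : r ∉ tsupport ξ := fun h => hr.2 ⟨(hK h).1, hr.1.2.le⟩
  rw [image_eq_zero_of_notMem_tsupport this, mul_zero]

lemma setIntegral_eq_of_test {F ξ : ℝ → ℝ} {a : ℝ} (ha : 0 < a) (ha1 : a ≤ 1)
    (hF : ∀ r, r < a → F r * ξ r = 0) :
    ∫ r in Ioo (0 : ℝ) 1, F r * ξ r = ∫ r in a..1, F r * ξ r := by
  rw [intervalIntegral.integral_of_le ha1, ← integral_Icc_eq_integral_Ioc,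
    ← integral_Icc_eq_integral_Ioo]
  refine setIntegral_eq_of_subset_of_forall_sdiff_eq_zero measurableSet_Icc
    (Icc_subset_Icc_left ha.le) fun r hr => hF r ?_
  by_contra! h
  exact hr.2 ⟨h, hr.1.2⟩

/-- The lemma of du Bois-Reymond: a function with zero weak derivative is constant. -/
lemma ae_eq_const_of_integral_mul_deriv_eq_zero {D : ℝ → ℝ}
    (hD : ∀ a : ℝ, 0 < a → a ≤ 1 → IntervalIntegrable D volume a 1)
    (h : ∀ η : ℝ → ℝ, ContDiff ℝ ∞ η → HasCompactSupport η → tsupport η ⊆ Ioo (0 : ℝ) 1 →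
      ∫ r in Ioo (0 : ℝ) 1, D r * deriv η r = 0) :
    ∃ c : ℝ, ∀ᵐ r, r ∈ Ioo (0 : ℝ) 1 → D r = c := by
  let β : ContDiffBump (1 / 2 : ℝ) := ⟨1 / 8, 1 / 4, by norm_num, by norm_num⟩
  set ξ₀ : ℝ → ℝ := β.normed volume with hξ₀
  have h0s : ContDiff ℝ ∞ ξ₀ := β.contDiff_normed
  have h0c : HasCompactSupport ξ₀ := β.hasCompactSupport_normed
  have h0t : tsupport ξ₀ ⊆ Ioo (0 : ℝ) 1 := by
    rw [hξ₀, β.tsupport_normed_eq, Real.closedBall_eq_Icc]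
    intro x hx
    have h1 : (1 / 2 - 1 / 4 : ℝ) ≤ x := hx.1
    have h2 : x ≤ (1 / 2 + 1 / 4 : ℝ) := hx.2
    constructor <;> linarith
  have h0i : ∫ x, ξ₀ x = 1 := β.integral_normed
  set c : ℝ := ∫ r in Ioo (0 : ℝ) 1, D r * ξ₀ r with hc
  refine ⟨c, ?_⟩
  have hloc : LocallyIntegrableOn (fun r => D r - c) (Ioo (0 : ℝ) 1) := by
    rw [locallyIntegrableOn_iff isOpen_Ioo.isLocallyClosed]
    intro K hKs hK
    obtain ⟨a, b, ha, hab, hb, hK'⟩ := exists_Icc_of_isCompact_subset hK hKs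
    have h1 := (hD a ha (hab.trans hb).le).sub (intervalIntegrable_const (c := c))
    rw [intervalIntegrable_iff_integrableOn_Ioc_of_le (hab.trans hb).le,
      ← integrableOn_Icc_iff_integrableOn_Ioc] at h1
    exact h1.mono_set (hK'.trans (Icc_subset_Icc_right hb.le))
  have key := isOpen_Ioo.ae_eq_zero_of_integral_contDiff_smul_eq_zero hloc ?_
  · filter_upwards [key] with r hr h1
    linarith [hr h1]
  intro ξ hξ hξc hξs
  set k : ℝ := ∫ x, ξ x with hk
  set θ : ℝ → ℝ := fun x => ξ x - k * ξ₀ x with hθ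
  have hθs : ContDiff ℝ ∞ θ := hξ.sub (contDiff_const.mul h0s)
  obtain ⟨a, b, ha, hab, hb, hK⟩ := exists_Icc_of_isCompact_subset
    (hξc.isCompact.union h0c.isCompact) (union_subset hξs h0t)
  have hθ0 : ∀ x, x ∉ Icc a b → θ x = 0 := by
    intro x hx
    have h1 : x ∉ tsupport ξ := fun h => hx (hK (Or.inl h))
    have h2 : x ∉ tsupport ξ₀ := fun h => hx (hK (Or.inr h))
    simp [hθ, image_eq_zero_of_notMem_tsupport h1, image_eq_zero_of_notMem_tsupport h2]
  have hθsupp : Function.support θ ⊆ Icc a b := fun x hx => by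
    by_contra hn; exact hx (hθ0 x hn)
  have hξint : Integrable ξ := hξ.continuous.integrable_of_hasCompactSupport hξc
  have h0int : Integrable ξ₀ := h0s.continuous.integrable_of_hasCompactSupport h0c
  have hθi : ∫ x, θ x = 0 := by
    rw [hθ, integral_sub hξint (h0int.const_mul k), integral_const_mul, h0i]
    simp [hk]
  -- `θ` has zero mean, so its primitive is again a test function
  set η : ℝ → ℝ := fun x => ∫ t in (0 : ℝ)..x, θ t with hη
  have hηd : ∀ x, HasDerivAt η (θ x) x := fun x =>
    intervalIntegral.integral_hasDerivAt_right (hθs.continuous.intervalIntegrable _ _)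
      (hθs.continuous.stronglyMeasurableAtFilter _ _) hθs.continuous.continuousAt
  have hηderiv : deriv η = θ := funext fun x => (hηd x).deriv
  have hηs : ContDiff ℝ ∞ η := by
    rw [contDiff_infty_iff_deriv, hηderiv]
    exact ⟨fun x => (hηd x).differentiableAt, hθs⟩
  have hη0 : ∀ x, x ∉ Icc a b → η x = 0 := by
    intro x hx
    rcases lt_or_ge x a with hxa | hxa
    · refine intervalIntegral.integral_zero_ae (Filter.Eventually.of_forall fun t ht => hθ0 t ?_)
      intro h
      have : t ≤ max 0 x := ht.2
      have := max_lt ha hxa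
      linarith [h.1]
    · have hxb : b < x := by
        by_contra! hn; exact hx ⟨hxa, hn⟩
      rw [← hθi]
      refine intervalIntegral.integral_eq_integral_of_support_subset fun t ht => ?_
      have := hθsupp ht
      exact ⟨ha.trans_le this.1, this.2.trans hxb.le⟩
  have hηc : HasCompactSupport η := HasCompactSupport.intro isCompact_Icc hη0
  have hηt : tsupport η ⊆ Ioo (0 : ℝ) 1 := by
    have : tsupport η ⊆ Icc a b := closure_minimal (fun x hx => by
      by_contra hn; exact hx (hη0 x hn)) isClosed_Icc
    exact this.trans fun x hx => ⟨ha.trans_le hx.1, hx.2.trans_lt hb⟩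
  have hmain := h η hηs hηc hηt
  have hI1 := integrableOn_mul_test hD hξ.continuous hξc hξs
  have hI2 := integrableOn_mul_test hD h0s.continuous h0c h0t
  have e1 : ∫ r in Ioo (0 : ℝ) 1, D r * deriv η r =
      (∫ r in Ioo (0 : ℝ) 1, D r * ξ r) - k * c := by
    rw [hηderiv, hc, ← integral_const_mul, ← integral_sub hI1 (hI2.const_mul k)]
    refine integral_congr_ae (Filter.Eventually.of_forall fun r => ?_)
    simp only [hθ]; ring
  have e2 : k = ∫ r in Ioo (0 : ℝ) 1, ξ r := by
    rw [hk, ← setIntegral_eq_integral_of_forall_compl_eq_zero (s := Ioo (0 : ℝ) 1)]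
    intro x hx
    exact image_eq_zero_of_notMem_tsupport fun h => hx (hξs h)
  have e3 : ∫ r, ξ r • (D r - c) = ∫ r in Ioo (0 : ℝ) 1, ξ r • (D r - c) := by
    rw [setIntegral_eq_integral_of_forall_compl_eq_zero]
    intro x hx
    rw [image_eq_zero_of_notMem_tsupport fun h => hx (hξs h), zero_smul]
  have e4 : ∫ r in Ioo (0 : ℝ) 1, ξ r • (D r - c) =
      (∫ r in Ioo (0 : ℝ) 1, D r * ξ r) - c * ∫ r in Ioo (0 : ℝ) 1, ξ r := by
    rw [← integral_const_mul, ← integral_sub hI1 (hξint.integrableOn.const_mul c)]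
    refine integral_congr_ae (Filter.Eventually.of_forall fun r => ?_)
    simp only [smul_eq_mul]; ring
  rw [e3, e4, ← e2]
  rw [e1] at hmain
  linarith

/-- A function with an integrable weak derivative is a.e. a primitive of it. -/
lemma HasWeakDeriv.exists_ae_eq_primitive {u v : ℝ → ℝ} (h : HasWeakDeriv u v)
    (hu : ∀ a : ℝ, 0 < a → a ≤ 1 → IntervalIntegrable u volume a 1)
    (hv : ∀ a : ℝ, 0 < a → a ≤ 1 → IntervalIntegrable v volume a 1) :
    ∃ c : ℝ, ∀ᵐ r, r ∈ Ioo (0 : ℝ) 1 → u r = c + ∫ t in (1 : ℝ)..r, v t := by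
  set w : ℝ → ℝ := fun r => ∫ t in (1 : ℝ)..r, v t with hw
  have hwac : ∀ a : ℝ, 0 < a → a ≤ 1 → AbsolutelyContinuousOnInterval w a 1 := fun a h0 h1 =>
    (hv a h0 h1).absolutelyContinuousOnInterval_intervalIntegral right_mem_uIcc
  have hwi : ∀ a : ℝ, 0 < a → a ≤ 1 → IntervalIntegrable w volume a 1 := fun a h0 h1 =>
    (hwac a h0 h1).continuousOn.intervalIntegrable
  suffices hw0 : ∀ η : ℝ → ℝ, ContDiff ℝ ∞ η → HasCompactSupport η → tsupport η ⊆ Ioo (0 : ℝ) 1 →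
      ∫ r in Ioo (0 : ℝ) 1, (u r - w r) * deriv η r = 0 by
    obtain ⟨c, hc⟩ := ae_eq_const_of_integral_mul_deriv_eq_zero (D := fun r => u r - w r)
      (fun a h0 h1 => (hu a h0 h1).sub (hwi a h0 h1)) hw0
    refine ⟨c, ?_⟩
    filter_upwards [hc] with r hr h1
    linarith [hr h1]
  intro η hη hηc hηs
  have hη1 : ContDiff ℝ 1 η := hη.of_le (by exact_mod_cast le_top)
  have hdc : HasCompactSupport (deriv η) := hηc.deriv
  have hds : tsupport (deriv η) ⊆ Ioo (0 : ℝ) 1 :=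
    tsupport_deriv_subset.trans hηs
  have hdcont : Continuous (deriv η) := hη1.continuous_deriv le_rfl
  obtain ⟨a, b, ha, hab, hb, hK⟩ := exists_Icc_of_isCompact_subset hηc hηs
  have ha1 : a ≤ 1 := (hab.trans hb).le
  -- start strictly to the left of the support
  have ha2 : (0 : ℝ) < a / 2 := by positivity
  have ha21 : a / 2 ≤ 1 := by linarith
  have hzero : ∀ r, r < a → η r = 0 := fun r hr =>
    image_eq_zero_of_notMem_tsupport fun h => absurd (hK h).1 (not_le.2 hr)
  have hzero' : ∀ r, r < a → deriv η r = 0 := fun r hr =>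
    image_eq_zero_of_notMem_tsupport fun h =>
      absurd (hK (tsupport_deriv_subset h)).1 (not_le.2 hr)
  have hη1' : η 1 = 0 := image_eq_zero_of_notMem_tsupport fun h =>
    absurd (hηs h).2 (lt_irrefl _)
  have hηac : AbsolutelyContinuousOnInterval η (a / 2) 1 :=
    hη1.contDiffOn.absolutelyContinuousOnInterval
  have hparts := (hwac _ ha2 ha21).integral_mul_deriv_eq_deriv_mul hηac
  have hwd : ∫ r in (a / 2)..1, deriv w r * η r = ∫ r in (a / 2)..1, v r * η r := by
    refine intervalIntegral.integral_congr_ae ?_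
    filter_upwards [(hv _ ha2 ha21).ae_hasDerivAt_integral] with r hr hr1
    rw [(hr (uIoc_subset_uIcc hr1) 1 right_mem_uIcc).deriv]
  rw [hη1', hzero (a / 2) (by linarith), hwd] at hparts
  have e1 : ∫ r in Ioo (0 : ℝ) 1, w r * deriv η r = ∫ r in (a / 2)..1, w r * deriv η r :=
    setIntegral_eq_of_test ha2 ha21 fun r hr => by rw [hzero' r (by linarith), mul_zero]
  have e2 : ∫ r in Ioo (0 : ℝ) 1, v r * η r = ∫ r in (a / 2)..1, v r * η r :=
    setIntegral_eq_of_test ha2 ha21 fun r hr => by rw [hzero r (by linarith), mul_zero]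
  have e3 := h η hη hηc hηs
  have e4 : ∫ r in Ioo (0 : ℝ) 1, (u r - w r) * deriv η r =
      (∫ r in Ioo (0 : ℝ) 1, u r * deriv η r) - ∫ r in Ioo (0 : ℝ) 1, w r * deriv η r := by
    rw [← integral_sub (integrableOn_mul_test hu hdcont hdc hds)
      (integrableOn_mul_test hwi hdcont hdc hds)]
    refine integral_congr_ae (Filter.Eventually.of_forall fun r => ?_)
    simp only; ring
  rw [e4, e3, e1, hparts, e2]
  ring

lemma MemH11.integrable {u u' : ℝ → ℝ} (h : MemH11 u u') : Integrable u radialMeasure :=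
  h.memLp.integrable one_le_two

lemma MemH11.integrable_deriv {u u' : ℝ → ℝ} (h : MemH11 u u') : Integrable u' radialMeasure :=
  h.memLp_deriv.integrable one_le_two

lemma MemH11.exists_ae_eq_primitive {u u' : ℝ → ℝ} (h : MemH11 u u') :
    ∃ c : ℝ, ∀ᵐ r, r ∈ Ioo (0 : ℝ) 1 → u r = c + ∫ t in (1 : ℝ)..r, u' t :=
  h.weakDeriv.exists_ae_eq_primitive
    (fun _ h0 h1 => intervalIntegrable_of_radial h.integrable h0 h1 one_pos le_rfl)
    (fun _ h0 h1 => intervalIntegrable_of_radial h.integrable_deriv h0 h1 one_pos le_rfl)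

lemma continuousOn_primitive_Ioc {v : ℝ → ℝ} (hv : Integrable v radialMeasure) :
    ContinuousOn (fun r => ∫ t in (1 : ℝ)..r, v t) (Ioc 0 1) := by
  intro r hr
  have h2 : 0 < r / 2 := half_pos hr.1
  have h21 : r / 2 ≤ 1 := by linarith [hr.2, hr.1]
  have hac := (intervalIntegrable_of_radial hv h2 h21 one_pos
    le_rfl).absolutelyContinuousOnInterval_intervalIntegral right_mem_uIcc
  have hc := hac.continuousOn
  rw [uIcc_of_le h21] at hc
  refine (hc r ⟨by linarith [hr.1], hr.2⟩).mono_of_mem_nhdsWithin ?_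
  rw [mem_nhdsWithin]
  exact ⟨Ioi (r / 2), isOpen_Ioi, by simpa using hr.1, fun x hx => ⟨(mem_Ioi.1 hx.1).le, hx.2.2⟩⟩

lemma MemH11.ae_eq_primitive_of_vanishesAtRim {u u' : ℝ → ℝ} (h : MemH11 u u')
    (h0 : VanishesAtRim u) :
    ∀ᵐ r, r ∈ Ioo (0 : ℝ) 1 → u r = ∫ t in (1 : ℝ)..r, u' t := by
  obtain ⟨c, hc⟩ := h.exists_ae_eq_primitive
  obtain ⟨w, hw, huw, hw1⟩ := h0
  have huw' := (ae_radialMeasure_iff _).1 huw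
  have hae : w =ᵐ[volume.restrict (Ioc (0 : ℝ) 1)] fun r => c + ∫ t in (1 : ℝ)..r, u' t := by
    rw [← restrict_Ioo_eq_restrict_Ioc]
    have hc' := (ae_restrict_iff' (μ := volume) measurableSet_Ioo).2 hc
    filter_upwards [huw', hc'] with r h1 h2
    rw [← h1, h2]
  have heq := Measure.eqOn_Ioc_of_ae_eq volume hae hw
    (continuousOn_const.add (continuousOn_primitive_Ioc h.integrable_deriv))
  have h1 := heq (right_mem_Ioc.2 zero_lt_one)
  simp only [hw1, intervalIntegral.integral_same, add_zero] at h1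
  filter_upwards [hc] with r hr hr1
  rw [hr hr1, ← h1, zero_add]

/-! ### Integral inequalities from absolutely continuous functions -/

lemma integral_le_of_ae_le_deriv_add {Φ Φ' L R : ℝ → ℝ} {a b : ℝ} (hab : a ≤ b)
    (hΦ : AbsolutelyContinuousOnInterval Φ a b)
    (hd : ∀ᵐ t, t ∈ Ioo a b → HasDerivAt Φ (Φ' t) t)
    (hle : ∀ t ∈ Ioo a b, L t ≤ Φ' t + R t)
    (hL : IntervalIntegrable L volume a b) (hR : IntervalIntegrable R volume a b) :
    ∫ t in a..b, L t ≤ Φ b - Φ a + ∫ t in a..b, R t := by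
  rw [← hΦ.integral_deriv_eq_sub, ← intervalIntegral.integral_add hΦ.intervalIntegrable_deriv hR]
  refine intervalIntegral.integral_mono_ae_restrict hab hL (hΦ.intervalIntegrable_deriv.add hR) ?_
  rw [← restrict_Ioo_eq_restrict_Icc, EventuallyLE, ae_restrict_iff' measurableSet_Ioo]
  filter_upwards [hd] with t ht h1
  simpa only [(ht h1).deriv] using hle t h1

/-- A square integrable function for `s ds` has an integral of order `o(a)` over `(0, a)`. -/
lemma tendsto_integral_mul_abs_div {F : ℝ → ℝ}
    (hF : IntervalIntegrable (fun s => s * F s) volume 0 1)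
    (hF2 : IntervalIntegrable (fun s => s * F s ^ 2) volume 0 1) :
    Tendsto (fun a => (∫ s in (0 : ℝ)..a, s * |F s|) / a) (𝓝[>] 0) (𝓝 0) := by
  have hcont : Tendsto (fun a => ∫ s in (0 : ℝ)..a, s * F s ^ 2) (𝓝[>] 0) (𝓝 0) := by
    have h1 := (hF2.absolutelyContinuousOnInterval_intervalIntegral left_mem_uIcc).continuousOn 0
      left_mem_uIcc
    rw [ContinuousWithinAt, intervalIntegral.integral_same, uIcc_of_le zero_le_one] at h1
    exact h1.mono_left (nhdsWithin_le_of_mem (Icc_mem_nhdsGT zero_lt_one))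
  rw [Metric.tendsto_nhds]
  intro η hη
  filter_upwards [Ioo_mem_nhdsGT (zero_lt_one (α := ℝ)),
    hcont.eventually (gt_mem_nhds (show 0 < η ^ 2 by positivity))] with a ha he
  have hsub : uIcc (0 : ℝ) a ⊆ uIcc 0 1 := by
    rw [uIcc_of_le ha.1.le, uIcc_of_le zero_le_one]; exact Icc_subset_Icc_right ha.2.le
  have hIabs : IntervalIntegrable (fun s => s * |F s|) volume 0 a := by
    refine (hF.mono_set hsub).abs.congr fun s hs => ?_
    rw [uIoc_of_le ha.1.le] at hs
    simp only [abs_mul, abs_of_pos hs.1]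
  have hI2 := hF2.mono_set hsub
  have hnn : 0 ≤ ∫ s in (0 : ℝ)..a, s * |F s| :=
    intervalIntegral.integral_nonneg ha.1.le fun s hs => mul_nonneg hs.1 (abs_nonneg _)
  -- `2 |F| ≤ η / a + (a / η) F ^ 2`
  have hbd : ∫ s in (0 : ℝ)..a, s * |F s| ≤
      ∫ s in (0 : ℝ)..a, (η / (2 * a) * s + a / (2 * η) * (s * F s ^ 2)) := by
    refine intervalIntegral.integral_mono_on ha.1.le hIabs
      ((Continuous.intervalIntegrable (by fun_prop) _ _).add (hI2.const_mul _)) fun s hs => ?_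
    have ha0 := ha.1
    have h1 : 0 ≤ s * (a / (2 * η)) * (|F s| - η / a) ^ 2 :=
      mul_nonneg (mul_nonneg hs.1 (by positivity)) (sq_nonneg _)
    have h2 : s * (a / (2 * η)) * (|F s| - η / a) ^ 2 =
        η / (2 * a) * s + a / (2 * η) * (s * |F s| ^ 2) - s * |F s| := by
      field_simp
      ring
    rw [sq_abs] at h2
    linarith
  rw [intervalIntegral.integral_add (Continuous.intervalIntegrable (by fun_prop) _ _)
    (hI2.const_mul _), intervalIntegral.integral_const_mul, intervalIntegral.integral_const_mul,
    integral_id] at hbd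
  have ha0 := ha.1
  rw [Real.dist_eq, sub_zero, abs_of_nonneg (by positivity), div_lt_iff₀ ha0]
  have h3 : a / (2 * η) * (∫ s in (0 : ℝ)..a, s * F s ^ 2) < a / (2 * η) * η ^ 2 := by gcongr
  have h4 : η / (2 * a) * ((a ^ 2 - 0 ^ 2) / 2) = η * a / 4 := by field_simp; ring
  have h5 : a / (2 * η) * η ^ 2 = η * a / 2 := by field_simp
  nlinarith [mul_pos hη ha0]

/-- Primitives of radially integrable functions are `O(1 / a)` at the origin. -/
lemma abs_mul_primitive_le {v : ℝ → ℝ} (hv : Integrable v radialMeasure) {a : ℝ}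
    (ha : a ∈ Ioc (0 : ℝ) 1) :
    |a * ∫ t in (1 : ℝ)..a, v t| ≤ ∫ s in (0 : ℝ)..1, |s * v s| := by
  have h1 := ((integrable_radialMeasure_iff v).1 hv).abs
  have hsub : uIcc a 1 ⊆ uIcc 0 1 := by
    rw [uIcc_of_le ha.2, uIcc_of_le zero_le_one]; exact Icc_subset_Icc_left ha.1.le
  rw [intervalIntegral.integral_symm, mul_neg, abs_neg, ← intervalIntegral.integral_const_mul]
  calc |∫ t in a..1, a * v t| ≤ ∫ t in a..1, |a * v t| :=
        intervalIntegral.abs_integral_le_integral_abs ha.2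
    _ ≤ ∫ t in a..1, |t * v t| := by
        refine intervalIntegral.integral_mono_on ha.2
          ((intervalIntegrable_of_radial hv ha.1 ha.2 one_pos le_rfl).const_mul a).abs
          (h1.mono_set hsub) fun t ht => ?_
        rw [abs_mul, abs_mul, abs_of_pos ha.1, abs_of_pos (ha.1.trans_le ht.1)]
        exact mul_le_mul_of_nonneg_right ht.1 (abs_nonneg _)
    _ ≤ ∫ t in (0 : ℝ)..1, |t * v t| :=
        intervalIntegral.integral_mono_interval ha.1.le ha.2 le_rfl
          (Eventually.of_forall fun t => abs_nonneg _) h1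

/-- The identity `t ^ 2 ζ - 2 ∫₀ᵗ s ζ ds = ∫₀ᵗ s ^ 2 ζ' ds`, in the form of a bound. -/
lemma abs_sq_mul_sub_le {m : ℝ → ℝ} (hm : Integrable m radialMeasure)
    (hζ : Integrable (fun r => ∫ t in (1 : ℝ)..r, m t) radialMeasure) {t : ℝ}
    (ht : t ∈ Ioc (0 : ℝ) 1) :
    |t ^ 2 * (∫ s in (1 : ℝ)..t, m s) - 2 * ∫ s in (0 : ℝ)..t, s * ∫ x in (1 : ℝ)..s, m x| ≤
      t * ∫ s in (0 : ℝ)..t, s * |m s| := by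
  set ζ : ℝ → ℝ := fun r => ∫ t in (1 : ℝ)..r, m t with hζdef
  set Z : ℝ → ℝ := fun r => ∫ s in (0 : ℝ)..r, s * ζ s with hZdef
  change |t ^ 2 * ζ t - 2 * Z t| ≤ _
  have hζ' := (integrable_radialMeasure_iff ζ).1 hζ
  have hm' := (integrable_radialMeasure_iff m).1 hm
  have hmabs : IntervalIntegrable (fun s => s * |m s|) volume 0 1 := by
    refine hm'.abs.congr fun s hs => ?_
    rw [uIoc_of_le zero_le_one] at hs
    simp only [abs_mul, abs_of_pos hs.1]
  have hZac : AbsolutelyContinuousOnInterval Z 0 1 :=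
    hζ'.absolutelyContinuousOnInterval_intervalIntegral left_mem_uIcc
  have hbound : ∀ a ∈ Ioo 0 t, |t ^ 2 * ζ t - 2 * Z t| ≤
      |a ^ 2 * ζ a - 2 * Z a| + t * ∫ s in (0 : ℝ)..t, s * |m s| := by
    intro a ha
    have ha1 : a ≤ 1 := (ha.2.trans_le ht.2).le
    have hsub : uIcc a t ⊆ uIcc a 1 := by
      rw [uIcc_of_le ha.2.le, uIcc_of_le ha1]; exact Icc_subset_Icc_right ht.2
    have hsub0 : uIcc a 1 ⊆ uIcc 0 1 := by
      rw [uIcc_of_le zero_le_one, uIcc_of_le ha1]; exact Icc_subset_Icc_left ha.1.le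
    have hm1 := intervalIntegrable_of_radial hm ha.1 ha1 one_pos le_rfl
    have hζac : AbsolutelyContinuousOnInterval ζ a 1 :=
      hm1.absolutelyContinuousOnInterval_intervalIntegral right_mem_uIcc
    have hsqac : AbsolutelyContinuousOnInterval (fun t : ℝ => t ^ 2) a 1 :=
      ContDiffOn.absolutelyContinuousOnInterval (by fun_prop)
    have hQac : AbsolutelyContinuousOnInterval (fun t => t ^ 2 * ζ t - 2 * Z t) a t :=
      ((hsqac.fun_mul hζac).fun_sub ((hZac.mono hsub0).const_mul 2)).mono hsub
    have hI : ∫ s in a..t, deriv (fun t => t ^ 2 * ζ t - 2 * Z t) s = ∫ s in a..t, s ^ 2 * m s := by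
      refine intervalIntegral.integral_congr_ae ?_
      filter_upwards [hm1.ae_hasDerivAt_integral, hζ'.ae_hasDerivAt_integral] with s h1 h2 hs
      have hs' := hsub (uIoc_subset_uIcc hs)
      have e := ((hasDerivAt_pow 2 s).mul (h1 hs' 1 right_mem_uIcc)).sub
        ((h2 (hsub0 hs') 0 left_mem_uIcc).const_mul 2)
      refine e.deriv.trans ?_
      simp only [hζdef]
      push_cast
      ring
    rw [hQac.integral_deriv_eq_sub] at hI
    have hle : |∫ s in a..t, s ^ 2 * m s| ≤ t * ∫ s in (0 : ℝ)..t, s * |m s| := by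
      calc |∫ s in a..t, s ^ 2 * m s| ≤ ∫ s in a..t, |s ^ 2 * m s| :=
            intervalIntegral.abs_integral_le_integral_abs ha.2.le
        _ ≤ ∫ s in a..t, t * (s * |m s|) := by
            refine intervalIntegral.integral_mono_on ha.2.le
              ((hm1.mono_set hsub).continuousOn_mul (by fun_prop)).abs
              ((hmabs.mono_set (hsub.trans hsub0)).const_mul t) fun s hs => ?_
            have hs0 : 0 ≤ s := ha.1.le.trans hs.1
            rw [abs_mul, abs_of_nonneg (sq_nonneg s)]
            have := mul_le_mul_of_nonneg_right hs.2 (mul_nonneg hs0 (abs_nonneg (m s)))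
            linarith
        _ ≤ ∫ s in (0 : ℝ)..t, t * (s * |m s|) := by
            refine intervalIntegral.integral_mono_interval ha.1.le ha.2.le le_rfl ?_
              ((hmabs.mono_set ?_).const_mul t)
            · rw [EventuallyLE, ae_restrict_iff' measurableSet_Ioc]
              exact Eventually.of_forall fun s hs =>
                mul_nonneg ht.1.le (mul_nonneg hs.1.le (abs_nonneg _))
            · rw [uIcc_of_le ht.1.le, uIcc_of_le zero_le_one]
              exact Icc_subset_Icc_right ht.2
        _ = _ := intervalIntegral.integral_const_mul _ _
    have e : t ^ 2 * ζ t - 2 * Z t = (a ^ 2 * ζ a - 2 * Z a) + ∫ s in a..t, s ^ 2 * m s := by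
      rw [← hI]; ring
    rw [e]
    exact (abs_add_le _ _).trans (by gcongr)
  have hlim : Tendsto (fun a => |a ^ 2 * ζ a - 2 * Z a| + t * ∫ s in (0 : ℝ)..t, s * |m s|)
      (𝓝[>] 0) (𝓝 (|0 - 2 * 0| + t * ∫ s in (0 : ℝ)..t, s * |m s|)) := by
    refine (Tendsto.sub ?_ (Tendsto.const_mul 2 ?_)).abs.add tendsto_const_nhds
    · have hC : Tendsto (fun a : ℝ => a * ∫ s in (0 : ℝ)..1, |s * m s|) (𝓝[>] 0) (𝓝 0) := by
        have : Tendsto (fun a : ℝ => a * ∫ s in (0 : ℝ)..1, |s * m s|) (𝓝 0)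
            (𝓝 (0 * ∫ s in (0 : ℝ)..1, |s * m s|)) := tendsto_id.mul_const _
        rw [zero_mul] at this
        exact this.mono_left nhdsWithin_le_nhds
      refine squeeze_zero_norm' ?_ hC
      filter_upwards [Ioo_mem_nhdsGT (zero_lt_one (α := ℝ))] with a ha
      have := abs_mul_primitive_le hm ⟨ha.1, ha.2.le⟩
      rw [Real.norm_eq_abs, pow_two, mul_assoc, abs_mul, abs_of_pos ha.1]
      exact mul_le_mul_of_nonneg_left this ha.1.le
    · have h1 := hZac.continuousOn 0 left_mem_uIcc
      rw [ContinuousWithinAt, uIcc_of_le zero_le_one] at h1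
      have h0 : Z 0 = 0 := intervalIntegral.integral_same
      rw [h0] at h1
      exact h1.mono_left (nhdsWithin_le_of_mem (Icc_mem_nhdsGT zero_lt_one))
  have := ge_of_tendsto hlim (by
    filter_upwards [Ioo_mem_nhdsGT ht.1] with a ha
    exact hbound a ha)
  simpa using this

/-- The pointwise inequality behind the sharp lower bound for the energy. Here `f = ψ'`, `m = ζ'`,
`Z = ∫₀ᵗ s ζ ds`, `W` and `q + ε t ^ 4` are the perturbed profile and flux, and `G` is the derivative
of the latter over `t ^ 3`. The first bracket on the right is a total derivative, and the difference
of the two sides is a sum of squares. -/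
lemma pointwise_energy_inequality {t B ε W q G Ω f m ζ Z ψ : ℝ} (ht : 0 < t) (hB : 0 < B)
    (hε : 0 < ε) (hW : 0 < W) (hq : 0 < q + ε * t ^ 4) :
    2 * Ω * (ψ * ζ) * t ≤
      (2 * Ω * (f * Z + ψ * (t * ζ)) + 2 * Z * (t * ζ) * (1 / (3 * W) - 2 / t ^ 2) +
        Z ^ 2 * (-(W / t - (q + ε * t ^ 4) / t ^ 2) / (3 * W ^ 2) + 4 / t ^ 3) -
        (2 * (t ^ 2 * ζ - 2 * Z) * (t ^ 2 * m) * (G / (q + ε * t ^ 4)) +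
          (t ^ 2 * ζ - 2 * Z) ^ 2 * (B * (q / t ^ 3 - 1 / 3) / (q + ε * t ^ 4) -
            t ^ 3 * G ^ 2 / (q + ε * t ^ 4) ^ 2)) / B) +
      (Ω ^ 2 * (t * (W * f ^ 2)) + t * (ζ ^ 2 + 1 / B * m ^ 2)) := by
  set Q := t ^ 2 * ζ - 2 * Z with hQ
  obtain ⟨e, he⟩ : ∃ e, e = q + ε * t ^ 4 := ⟨_, rfl⟩
  rw [← he] at hq ⊢
  have hζ : ζ = (Q + 2 * Z) / t ^ 2 := by rw [hQ]; field_simp; ring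
  have hqe : q = e - ε * t ^ 4 := by rw [he]; ring
  have hsq : 0 ≤ t * W * (Ω * f + Z / (t * W)) ^ 2 + 1 / 3 * e * (Z / (t * W) + Q / e) ^ 2 +
      1 / B * t * (m - t * Q * (G / e)) ^ 2 + Q ^ 2 * ε * t / e := by positivity
  have hid : (2 * Ω * (f * Z + ψ * (t * ζ)) + 2 * Z * (t * ζ) * (1 / (3 * W) - 2 / t ^ 2) +
        Z ^ 2 * (-(W / t - e / t ^ 2) / (3 * W ^ 2) + 4 / t ^ 3) -
        (2 * Q * (t ^ 2 * m) * (G / e) +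
          Q ^ 2 * (B * (q / t ^ 3 - 1 / 3) / e - t ^ 3 * G ^ 2 / e ^ 2)) / B) +
      (Ω ^ 2 * (t * (W * f ^ 2)) + t * (ζ ^ 2 + 1 / B * m ^ 2)) - 2 * Ω * (ψ * ζ) * t =
      t * W * (Ω * f + Z / (t * W)) ^ 2 + 1 / 3 * e * (Z / (t * W) + Q / e) ^ 2 +
      1 / B * t * (m - t * Q * (G / e)) ^ 2 + Q ^ 2 * ε * t / e := by
    clear_value Q
    subst hζ hqe
    field_simp
    ring
  linarith

namespace IsReducedProfile

variable {B d ε : ℝ} {U p g : ℝ → ℝ}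

/-! ### Perturbed weights -/

lemma contDiff_flux (h : IsReducedProfile B d U p g) : ContDiff ℝ 1 (flux U p) := by
  have h1 := h.contDiff_U
  have h2 := h.contDiff_p
  unfold flux
  fun_prop

/-- The perturbation `U + ε (t - t ^ 3 / 2)` of the profile, positive on `(0, 1]`. It corresponds
to the perturbation `flux U p + ε t ^ 4` of the flux, and these two keep the weights in the
boundary terms finite at both end points. -/
noncomputable def perturbed (U : ℝ → ℝ) (ε t : ℝ) : ℝ := U t + ε * (t - t ^ 3 / 2)

lemma le_perturbed (h : IsReducedProfile B d U p g) (hB : 0 < B) (hε : 0 < ε) {t : ℝ}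
    (ht : t ∈ Ioc (0 : ℝ) 1) : ε * t / 2 ≤ perturbed U ε t := by
  have h1 := h.U_nonneg hB ⟨ht.1.le, ht.2⟩
  have h2 : t ^ 3 ≤ t := pow_le_of_le_one ht.1.le ht.2 (by norm_num)
  unfold perturbed
  nlinarith

lemma perturbed_pos (h : IsReducedProfile B d U p g) (hB : 0 < B) (hε : 0 < ε) {t : ℝ}
    (ht : t ∈ Ioc (0 : ℝ) 1) : 0 < perturbed U ε t :=
  lt_of_lt_of_le (by have := ht.1; positivity) (h.le_perturbed hB hε ht)

lemma hasDerivAt_perturbed (h : IsReducedProfile B d U p g) (hB : B ≠ 0) {t : ℝ} (ht : t ≠ 0) :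
    HasDerivAt (perturbed U ε) (perturbed U ε t / t - (flux U p t + ε * t ^ 4) / t ^ 2) t := by
  have h1 := (h.hasDerivAt_U_div hB ht).mul (hasDerivAt_id t)
  have h2 : HasDerivAt U (-(flux U p t / t ^ 3) * t + U t / t * 1) t := by
    refine h1.congr_of_eventuallyEq ?_
    filter_upwards [isOpen_ne.mem_nhds ht] with x hx
    have : x ≠ 0 := hx
    simp
    field_simp
  refine (h2.add (((hasDerivAt_id t).sub ((hasDerivAt_pow 3 t).div_const 2)).const_mul
    ε)).congr_deriv ?_
  simp only [perturbed]
  push_cast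
  field_simp
  ring

lemma flux_add_pos (h : IsReducedProfile B d U p g) (hB : 0 < B) (hε : 0 < ε) {t : ℝ}
    (ht : t ∈ Ioc (0 : ℝ) 1) : 0 < flux U p t + ε * t ^ 4 :=
  add_pos_of_nonneg_of_pos (h.flux_nonneg hB ⟨ht.1.le, ht.2⟩) (by have := ht.1; positivity)

/-- The function differentiated here is the coefficient of `Z ^ 2`, with `Z = ∫₀ᵗ s ζ ds`, in the
boundary term of `energy_inequality_perturbed`. -/
lemma hasDerivAt_weight_K (h : IsReducedProfile B d U p g) (hB : 0 < B) (hε : 0 < ε) {t : ℝ}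
    (ht : t ∈ Ioc (0 : ℝ) 1) :
    HasDerivAt (fun t => 1 / (3 * perturbed U ε t) - 2 / t ^ 2)
      (-(perturbed U ε t / t - (flux U p t + ε * t ^ 4) / t ^ 2) / (3 * perturbed U ε t ^ 2) +
        4 / t ^ 3) t := by
  have hW := h.perturbed_pos hB hε ht
  have ht0 := ht.1.ne'
  have h1 := (((h.hasDerivAt_perturbed (ε := ε) hB.ne' ht0).const_mul 3).fun_inv
    (by positivity)).sub (((hasDerivAt_pow 2 t).fun_inv (by positivity)).const_mul 2)
  simp only [div_eq_mul_inv, one_mul] at h1 ⊢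
  refine h1.congr_deriv ?_
  push_cast
  field_simp
  ring

/-- The function differentiated here is the logarithmic derivative of the perturbed flux, divided by
`t ^ 3`; it is the coefficient of `Q ^ 2`, with `Q = t ^ 2 ζ - 2 Z`, in the boundary term of
`energy_inequality_perturbed`. -/
lemma hasDerivAt_weight_tau (h : IsReducedProfile B d U p g) (hB : 0 < B) (hε : 0 < ε) {t : ℝ}
    (ht : t ∈ Ioc (0 : ℝ) 1) :
    HasDerivAt (fun t => (4 * ε - g t / t) / (flux U p t + ε * t ^ 4))
      (B * (flux U p t / t ^ 3 - 1 / 3) / (flux U p t + ε * t ^ 4) -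
        t ^ 3 * (4 * ε - g t / t) ^ 2 / (flux U p t + ε * t ^ 4) ^ 2) t := by
  have hq := h.flux_add_pos hB hε ht
  have ht0 := ht.1.ne'
  have h1 := ((h.hasDerivAt_g_div hB.ne' ht0).const_sub (4 * ε)).fun_div
    ((h.hasDerivAt_flux hB.ne' t).add ((hasDerivAt_pow 4 t).const_mul ε)) hq.ne'
  refine h1.congr_deriv ?_
  simp only [Pi.add_apply]
  generalize flux U p t = q at hq ⊢
  push_cast
  field_simp
  ring

lemma absolutelyContinuous_weight_K (h : IsReducedProfile B d U p g) (hB : 0 < B) (hε : 0 < ε)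
    {a : ℝ} (ha : a ∈ Ioc (0 : ℝ) 1) :
    AbsolutelyContinuousOnInterval (fun t => 1 / (3 * perturbed U ε t) - 2 / t ^ 2) a 1 := by
  refine ContDiffOn.absolutelyContinuousOnInterval ?_
  rw [uIcc_of_le ha.2]
  have hU := h.contDiff_U
  have hW : ContDiff ℝ 1 (perturbed U ε) := by unfold perturbed; fun_prop
  refine (contDiffOn_const.div (contDiff_const.mul hW).contDiffOn fun t ht => ?_).sub
    (contDiffOn_const.div (contDiff_id.pow 2).contDiffOn fun t ht => ?_)
  · have := h.perturbed_pos hB hε ⟨ha.1.trans_le ht.1, ht.2⟩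
    positivity
  · have := ha.1.trans_le ht.1
    positivity

lemma absolutelyContinuous_weight_tau (h : IsReducedProfile B d U p g) (hB : 0 < B) (hε : 0 < ε)
    {a : ℝ} (ha : a ∈ Ioc (0 : ℝ) 1) :
    AbsolutelyContinuousOnInterval
      (fun t => (4 * ε - g t / t) / (flux U p t + ε * t ^ 4)) a 1 := by
  refine ContDiffOn.absolutelyContinuousOnInterval ?_
  rw [uIcc_of_le ha.2]
  have hF : ContDiff ℝ 1 fun t => flux U p t + ε * t ^ 4 := by
    have := h.contDiff_flux
    fun_prop
  refine ContDiffOn.div (contDiffOn_const.sub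
    (h.contDiff_g.contDiffOn.div contDiff_id.contDiffOn fun t ht => ?_)) hF.contDiffOn fun t ht => ?_
  · exact (ha.1.trans_le ht.1).ne'
  · exact (h.flux_add_pos hB hε ⟨ha.1.trans_le ht.1, ht.2⟩).ne'

lemma abs_weight_K_le (h : IsReducedProfile B d U p g) (hB : 0 < B) (hε : 0 < ε) {t : ℝ}
    (ht : t ∈ Ioc (0 : ℝ) 1) :
    |t ^ 2 * (1 / (3 * perturbed U ε t) - 2 / t ^ 2)| ≤ 1 / ε + 2 := by
  have hW := h.perturbed_pos hB hε ht
  have hle := h.le_perturbed hB hε ht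
  have ht0 := ht.1
  have e : t ^ 2 * (1 / (3 * perturbed U ε t) - 2 / t ^ 2) = t ^ 2 / (3 * perturbed U ε t) - 2 := by
    field_simp
  have h1 : 0 ≤ t ^ 2 / (3 * perturbed U ε t) := by positivity
  have h2 : t ^ 2 / (3 * perturbed U ε t) ≤ 1 / ε := by
    rw [div_le_div_iff₀ (by positivity) hε]
    nlinarith [mul_le_mul_of_nonneg_left ht.2 (mul_pos ht0 hε).le]
  rw [e, abs_le]
  constructor <;> linarith [show 0 < 1 / ε by positivity]

lemma exists_abs_weight_tau_le (h : IsReducedProfile B d U p g) (hB : 0 < B) (hε : 0 < ε) :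
    ∃ C : ℝ, ∀ t ∈ Ioc (0 : ℝ) 1,
      |t ^ 4 * ((4 * ε - g t / t) / (flux U p t + ε * t ^ 4))| ≤ C := by
  obtain ⟨K, hK⟩ := (h.contDiff_g.contDiffOn (s := Icc (0 : ℝ) 1)).exists_lipschitzOnWith
    one_ne_zero (convex_Icc _ _) isCompact_Icc
  refine ⟨(4 * ε + K) / ε, fun t ht => ?_⟩
  have hq := h.flux_nonneg hB ⟨ht.1.le, ht.2⟩
  have hqe := h.flux_add_pos hB hε ht
  have ht0 := ht.1
  have hg : |g t| ≤ K * t := by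
    have := hK.dist_le_mul t ⟨ht.1.le, ht.2⟩ 0 (left_mem_Icc.2 zero_le_one)
    rwa [h.g_zero, Real.dist_eq, Real.dist_eq, sub_zero, sub_zero, abs_of_pos ht0] at this
  have hG : |4 * ε - g t / t| ≤ 4 * ε + K := by
    refine (abs_sub _ _).trans ?_
    rw [abs_of_pos (by positivity : 0 < 4 * ε), abs_div, abs_of_pos ht0]
    gcongr
    rwa [div_le_iff₀ ht0]
  have e : t ^ 4 * ((4 * ε - g t / t) / (flux U p t + ε * t ^ 4)) =
      (4 * ε - g t / t) * (t ^ 4 / (flux U p t + ε * t ^ 4)) := by ring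
  have h1 : t ^ 4 / (flux U p t + ε * t ^ 4) ≤ 1 / ε := by
    rw [div_le_div_iff₀ hqe hε]
    linarith
  rw [e, abs_mul, abs_of_nonneg (by positivity : 0 ≤ t ^ 4 / (flux U p t + ε * t ^ 4)),
    div_eq_mul_one_div (4 * ε + K : ℝ)]
  gcongr

end IsReducedProfile

/-! ### The sharp lower bound for the energy -/

namespace IsReducedProfile

variable {B d ε : ℝ} {U p g : ℝ → ℝ}

/-- The energy inequality with the perturbed weights, for the primitives `c + ∫₁ʳ f` and `∫₁ʳ m`:
`pointwise_energy_inequality` is integrated over `(a, 1)`, where the function `Φ` below collects the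
boundary terms, which vanish at `1` and tend to zero as `a → 0`. -/
lemma energy_inequality_perturbed (h : IsReducedProfile B d U p g) (hB : 0 < B) (hε : 0 < ε)
    (Ω c : ℝ) {f m : ℝ → ℝ} (hf : MemLp f 2 radialMeasure) (hm : MemLp m 2 radialMeasure)
    (hψ : MemLp (fun r => c + ∫ t in (1 : ℝ)..r, f t) 2 radialMeasure)
    (hζ : MemLp (fun r => ∫ t in (1 : ℝ)..r, m t) 2 radialMeasure)
    (hmean : ∫ r, (∫ t in (1 : ℝ)..r, m t) ∂radialMeasure = 0) :
    ∫ t in (0 : ℝ)..1, 2 * Ω * ((c + ∫ s in (1 : ℝ)..t, f s) * ∫ s in (1 : ℝ)..t, m s) * t ≤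
      ∫ t in (0 : ℝ)..1, (Ω ^ 2 * (t * (perturbed U ε t * f t ^ 2)) +
        t * ((∫ s in (1 : ℝ)..t, m s) ^ 2 + 1 / B * m t ^ 2)) := by
  set ψ : ℝ → ℝ := fun r => c + ∫ t in (1 : ℝ)..r, f t with hψdef
  set ζ : ℝ → ℝ := fun r => ∫ t in (1 : ℝ)..r, m t with hζdef
  set Z : ℝ → ℝ := fun r => ∫ s in (0 : ℝ)..r, s * ζ s with hZdef
  set L : ℝ → ℝ := fun t => 2 * Ω * (ψ t * ζ t) * t with hLdef
  set R : ℝ → ℝ := fun t => Ω ^ 2 * (t * (perturbed U ε t * f t ^ 2)) +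
    t * (ζ t ^ 2 + 1 / B * m t ^ 2) with hRdef
  change ∫ t in (0 : ℝ)..1, L t ≤ ∫ t in (0 : ℝ)..1, R t
  set K : ℝ → ℝ := fun t => 1 / (3 * perturbed U ε t) - 2 / t ^ 2 with hK
  set τ : ℝ → ℝ := fun t => (4 * ε - g t / t) / (flux U p t + ε * t ^ 4) with hτ
  set Q : ℝ → ℝ := fun t => t ^ 2 * ζ t - 2 * Z t with hQ
  set Φ : ℝ → ℝ := fun t => 2 * Ω * (ψ t * Z t) + Z t * Z t * K t - 1 / B * (Q t * Q t * τ t)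
    with hΦ
  have hfi := hf.integrable one_le_two
  have hmi := hm.integrable one_le_two
  have hζi := hζ.integrable one_le_two
  have hsζ := (integrable_radialMeasure_iff ζ).1 hζi
  have hZac : AbsolutelyContinuousOnInterval Z 0 1 :=
    hsζ.absolutelyContinuousOnInterval_intervalIntegral left_mem_uIcc
  have hZ1 : Z 1 = 0 := by rw [← hmean, integral_radialMeasure]
  have hW : Continuous (perturbed U ε) := by
    have := h.continuous_U
    unfold perturbed
    fun_prop
  have hLint : IntervalIntegrable L volume 0 1 := by
    have h1 := ((integrable_radialMeasure_iff _).1 (hψ.integrable_mul hζ)).const_mul (2 * Ω)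
    refine h1.congr fun t _ => ?_
    simp only [hLdef, Pi.mul_apply]
    ring
  have hRint : IntervalIntegrable R volume 0 1 := by
    have h1 := ((integrable_radialMeasure_iff _).1 hf.integrable_sq).continuousOn_mul
      (g := fun t => Ω ^ 2 * perturbed U ε t) (by fun_prop)
    have h2 := (integrable_radialMeasure_iff _).1
      (hζ.integrable_sq.add (hm.integrable_sq.const_mul (1 / B)))
    refine (h1.add h2).congr fun t _ => ?_
    simp only [hRdef, Pi.add_apply]
    ring
  have hstep : ∀ a ∈ Ioo (0 : ℝ) 1,
      ∫ t in a..1, L t ≤ -Φ a + ∫ t in a..1, R t := by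
    intro a ha
    have ha1 : a ≤ 1 := ha.2.le
    have hsub0 : uIcc a 1 ⊆ uIcc 0 1 := by
      rw [uIcc_of_le zero_le_one, uIcc_of_le ha1]; exact Icc_subset_Icc_left ha.1.le
    have hIoo : Ioo a 1 ⊆ uIcc a 1 := by
      rw [uIcc_of_le ha1]; exact Ioo_subset_Icc_self
    have hf1 := intervalIntegrable_of_radial hfi ha.1 ha1 one_pos le_rfl
    have hm1 := intervalIntegrable_of_radial hmi ha.1 ha1 one_pos le_rfl
    have hcac : AbsolutelyContinuousOnInterval (fun _ : ℝ => c) a 1 :=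
      ContDiffOn.absolutelyContinuousOnInterval contDiffOn_const
    have hψac : AbsolutelyContinuousOnInterval ψ a 1 :=
      hcac.fun_add (hf1.absolutelyContinuousOnInterval_intervalIntegral right_mem_uIcc)
    have hζac : AbsolutelyContinuousOnInterval ζ a 1 :=
      hm1.absolutelyContinuousOnInterval_intervalIntegral right_mem_uIcc
    have hZac1 := hZac.mono hsub0
    have hsqac : AbsolutelyContinuousOnInterval (fun t : ℝ => t ^ 2) a 1 :=
      ContDiffOn.absolutelyContinuousOnInterval (by fun_prop)
    have hQac : AbsolutelyContinuousOnInterval Q a 1 :=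
      (hsqac.fun_mul hζac).fun_sub (hZac1.const_mul 2)
    have hKac := h.absolutelyContinuous_weight_K hB hε ⟨ha.1, ha1⟩
    have hτac := h.absolutelyContinuous_weight_tau hB hε ⟨ha.1, ha1⟩
    have hΦac : AbsolutelyContinuousOnInterval Φ a 1 :=
      (((hψac.fun_mul hZac1).const_mul (2 * Ω)).fun_add
        ((hZac1.fun_mul hZac1).fun_mul hKac)).fun_sub
        (((hQac.fun_mul hQac).fun_mul hτac).const_mul (1 / B))
    have hΦ1 : Φ 1 = 0 := by
      have : ζ 1 = 0 := intervalIntegral.integral_same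
      simp [hΦ, hQ, hZ1, this]
    have := integral_le_of_ae_le_deriv_add ha1 hΦac (Φ' := fun t =>
      2 * Ω * (f t * Z t + ψ t * (t * ζ t)) +
        2 * Z t * (t * ζ t) * (1 / (3 * perturbed U ε t) - 2 / t ^ 2) +
        Z t ^ 2 * (-(perturbed U ε t / t - (flux U p t + ε * t ^ 4) / t ^ 2) /
          (3 * perturbed U ε t ^ 2) + 4 / t ^ 3) -
        (2 * (t ^ 2 * ζ t - 2 * Z t) * (t ^ 2 * m t) *
          ((4 * ε - g t / t) / (flux U p t + ε * t ^ 4)) +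
          (t ^ 2 * ζ t - 2 * Z t) ^ 2 *
          (B * (flux U p t / t ^ 3 - 1 / 3) / (flux U p t + ε * t ^ 4) -
            t ^ 3 * (4 * ε - g t / t) ^ 2 / (flux U p t + ε * t ^ 4) ^ 2)) / B)
      ?_ (fun t ht => pointwise_energy_inequality (ha.1.trans ht.1) hB hε
        (h.perturbed_pos hB hε ⟨ha.1.trans ht.1, ht.2.le⟩)
        (h.flux_add_pos hB hε ⟨ha.1.trans ht.1, ht.2.le⟩)) (hLint.mono_set hsub0)
      (hRint.mono_set hsub0)
    · rwa [hΦ1, zero_sub] at this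
    filter_upwards [hf1.ae_hasDerivAt_integral, hm1.ae_hasDerivAt_integral,
      hsζ.ae_hasDerivAt_integral] with t h1 h2 h3 ht
    have ht' := hIoo ht
    have dψ : HasDerivAt ψ (f t) t := (h1 ht' 1 right_mem_uIcc).const_add c
    have dζ : HasDerivAt ζ (m t) t := h2 ht' 1 right_mem_uIcc
    have dZ : HasDerivAt Z (t * ζ t) t := h3 (hsub0 ht') 0 left_mem_uIcc
    have dQ : HasDerivAt Q (t ^ 2 * m t) t := by
      refine (((hasDerivAt_pow 2 t).mul dζ).sub (dZ.const_mul 2)).congr_deriv ?_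
      push_cast
      ring
    have htI : t ∈ Ioc (0 : ℝ) 1 := ⟨ha.1.trans ht.1, ht.2.le⟩
    have dK := h.hasDerivAt_weight_K hB hε htI
    have dτ := h.hasDerivAt_weight_tau hB hε htI
    refine ((((dψ.mul dZ).const_mul (2 * Ω)).add ((dZ.mul dZ).mul dK)).sub
      (((dQ.mul dQ).mul dτ).const_mul (1 / B))).congr_deriv ?_
    simp only [hQ, Pi.mul_apply]
    ring
  -- the boundary term at `a` tends to zero with `a`
  obtain ⟨C, hC⟩ := h.exists_abs_weight_tau_le hB hε
  have hb1 := tendsto_integral_mul_abs_div hsζ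
    ((integrable_radialMeasure_iff _).1 hζ.integrable_sq)
  have hb2 := tendsto_integral_mul_abs_div ((integrable_radialMeasure_iff _).1 hmi)
    ((integrable_radialMeasure_iff _).1 hm.integrable_sq)
  obtain ⟨A, hA0, hA⟩ : ∃ A : ℝ, 0 ≤ A ∧ ∀ a ∈ Ioc (0 : ℝ) 1, |a * ψ a| ≤ A := by
    refine ⟨|c| + ∫ s in (0 : ℝ)..1, |s * f s|, add_nonneg (abs_nonneg _)
      (intervalIntegral.integral_nonneg zero_le_one fun _ _ => abs_nonneg _), fun a ha => ?_⟩
    have h1 : a * ψ a = a * c + a * ∫ s in (1 : ℝ)..a, f s := by simp only [hψdef]; ring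
    rw [h1]
    refine (abs_add_le _ _).trans (add_le_add ?_ (abs_mul_primitive_le hfi ha))
    rw [abs_mul, abs_of_pos ha.1]
    exact mul_le_of_le_one_left (abs_nonneg _) ha.2
  have hΦlim : Tendsto Φ (𝓝[>] 0) (𝓝 0) := by
    have hlim := ((hb1.const_mul (2 * |Ω| * A)).add
      ((hb1.pow 2).mul_const (1 / ε + 2))).add (((hb2.pow 2).mul_const C).const_mul (1 / B))
    norm_num at hlim
    refine squeeze_zero_norm' ?_ hlim
    filter_upwards [Ioo_mem_nhdsGT (zero_lt_one (α := ℝ))] with a ha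
    have haI : a ∈ Ioc (0 : ℝ) 1 := ⟨ha.1, ha.2.le⟩
    have ha0 := ha.1
    have hZa : |Z a / a| ≤ (∫ s in (0 : ℝ)..a, s * |ζ s|) / a := by
      rw [abs_div, abs_of_pos ha0]
      gcongr
      refine (intervalIntegral.abs_integral_le_integral_abs ha0.le).trans_eq ?_
      refine intervalIntegral.integral_congr fun s hs => ?_
      rw [uIcc_of_le ha0.le] at hs
      simp only [abs_mul, abs_of_nonneg hs.1]
    have hQa : |Q a / a ^ 2| ≤ (∫ s in (0 : ℝ)..a, s * |m s|) / a := by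
      rw [abs_div, abs_of_pos (pow_pos ha0 2), div_le_div_iff₀ (pow_pos ha0 2) ha0]
      have := mul_le_mul_of_nonneg_right (abs_sq_mul_sub_le hmi hζi haI) ha0.le
      calc |Q a| * a ≤ _ := this
        _ = _ := by ring
    have hψa := hA a haI
    have e : Φ a = 2 * Ω * ((a * ψ a) * (Z a / a)) + (Z a / a) ^ 2 * (a ^ 2 * K a) -
        1 / B * ((Q a / a ^ 2) ^ 2 * (a ^ 4 * τ a)) := by
      simp only [hΦ]
      generalize K a = k
      generalize τ a = t
      generalize Q a = q
      field_simp
    rw [Real.norm_eq_abs, e]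
    refine (abs_sub _ _).trans (add_le_add ((abs_add_le _ _).trans (add_le_add ?_ ?_)) ?_)
    · rw [abs_mul, abs_mul, abs_mul, abs_two, ← mul_assoc]
      gcongr
    · rw [abs_mul, abs_pow]
      have := h.abs_weight_K_le hB hε haI
      have h0 := abs_nonneg (Z a / a)
      rw [← one_div]
      gcongr
    · rw [abs_mul, abs_mul, abs_pow, abs_of_pos (by positivity : 0 < 1 / B), ← one_div]
      gcongr
      exact hC a haI
  have hIlim : ∀ F : ℝ → ℝ, IntervalIntegrable F volume 0 1 →
      Tendsto (fun a => ∫ t in a..1, F t) (𝓝[>] 0) (𝓝 (∫ t in (0 : ℝ)..1, F t)) := by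
    intro F hF
    have h1 := (hF.absolutelyContinuousOnInterval_intervalIntegral right_mem_uIcc).continuousOn 0
      left_mem_uIcc
    rw [ContinuousWithinAt, uIcc_of_le zero_le_one] at h1
    have h2 := (h1.mono_left (nhdsWithin_le_of_mem (Icc_mem_nhdsGT zero_lt_one))).neg
    simpa only [← intervalIntegral.integral_symm] using h2
  have hfin := le_of_tendsto_of_tendsto (hIlim L hLint) (hΦlim.neg.add (hIlim R hRint)) (by
    filter_upwards [Ioo_mem_nhdsGT (zero_lt_one (α := ℝ))] with a ha
    exact hstep a ha)
  simpa using hfin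

/-- For the container with bottom `U`, every pair of potential and pinned surface height of zero
mean satisfies `2 Ω ∫ ψ ζ ≤ Ω ^ 2 ∫ U ψ' ^ 2 + ∫ (ζ ^ 2 + ζ' ^ 2 / B)`. -/
lemma energy_inequality (h : IsReducedProfile B d U p g) (hB : 0 < B) (Ω : ℝ)
    {ψ ψ' ζ ζ' : ℝ → ℝ} (ht : IsTrialPair ψ ψ' ζ ζ') :
    2 * Ω * ∫ r, ψ r * ζ r ∂radialMeasure ≤
      Ω ^ 2 * ∫ r, U r * ψ' r ^ 2 ∂radialMeasure +
        ∫ r, (ζ r ^ 2 + 1 / B * ζ' r ^ 2) ∂radialMeasure := by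
  obtain ⟨c, hc⟩ := ht.potential.exists_ae_eq_primitive
  have hz := ht.height.ae_eq_primitive_of_vanishesAtRim ht.pinned
  have hc' : ψ =ᵐ[radialMeasure] fun r => c + ∫ t in (1 : ℝ)..r, ψ' t :=
    (ae_radialMeasure_iff _).2 ((ae_restrict_iff' measurableSet_Ioo).2 hc)
  have hz' : ζ =ᵐ[radialMeasure] fun r => ∫ t in (1 : ℝ)..r, ζ' t :=
    (ae_radialMeasure_iff _).2 ((ae_restrict_iff' measurableSet_Ioo).2 hz)
  have hf := ht.potential.memLp_deriv
  have hm := ht.height.memLp_deriv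
  have hψ := (memLp_congr_ae hc').1 ht.potential.memLp
  have hζ := (memLp_congr_ae hz').1 ht.height.memLp
  have hmean : ∫ r, (∫ t in (1 : ℝ)..r, ζ' t) ∂radialMeasure = 0 := by
    rw [← integral_congr_ae hz', ht.mean_zero]
  have e1 : ∫ r, ψ r * ζ r ∂radialMeasure =
      ∫ r, (c + ∫ t in (1 : ℝ)..r, ψ' t) * (∫ t in (1 : ℝ)..r, ζ' t) ∂radialMeasure :=
    integral_congr_ae (hc'.mul hz')
  have e2 : ∫ r, (ζ r ^ 2 + 1 / B * ζ' r ^ 2) ∂radialMeasure =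
      ∫ r, ((∫ t in (1 : ℝ)..r, ζ' t) ^ 2 + 1 / B * ζ' r ^ 2) ∂radialMeasure := by
    refine integral_congr_ae ?_
    filter_upwards [hz'] with r hr
    rw [hr]
  have hf2 := (integrable_radialMeasure_iff _).1 hf.integrable_sq
  have hU := h.continuous_U
  have hI1 : IntervalIntegrable (fun t => t * (U t * ψ' t ^ 2)) volume 0 1 :=
    (hf2.continuousOn_mul (g := U) hU.continuousOn).congr fun t _ => by ring
  have hI2 : IntervalIntegrable (fun t => (t - t ^ 3 / 2) * (t * ψ' t ^ 2)) volume 0 1 :=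
    hf2.continuousOn_mul (g := fun t => t - t ^ 3 / 2) (by fun_prop)
  have hI3 : IntervalIntegrable (fun t => t * ((∫ s in (1 : ℝ)..t, ζ' s) ^ 2 + 1 / B * ζ' t ^ 2))
      volume 0 1 := (integrable_radialMeasure_iff _).1
    (hζ.integrable_sq.add (hm.integrable_sq.const_mul (1 / B)))
  set C := ∫ t in (0 : ℝ)..1, (t - t ^ 3 / 2) * (t * ψ' t ^ 2) with hC
  rw [e1, e2, integral_radialMeasure, integral_radialMeasure, integral_radialMeasure]
  refine le_of_forall_pos_le_add fun δ hδ => ?_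
  have hden : 0 < Ω ^ 2 * |C| + 1 := by positivity
  have hε : 0 < δ / (Ω ^ 2 * |C| + 1) := div_pos hδ hden
  have key := h.energy_inequality_perturbed hB hε Ω c hf hm hψ hζ hmean
  set ε := δ / (Ω ^ 2 * |C| + 1) with hεdef
  have k1 : ∫ t in (0 : ℝ)..1, 2 * Ω * ((c + ∫ s in (1 : ℝ)..t, ψ' s) *
      ∫ s in (1 : ℝ)..t, ζ' s) * t = 2 * Ω * ∫ t in (0 : ℝ)..1, t * ((c + ∫ s in (1 : ℝ)..t, ψ' s) *
      ∫ s in (1 : ℝ)..t, ζ' s) := by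
    rw [← intervalIntegral.integral_const_mul]
    exact intervalIntegral.integral_congr fun t _ => by ring
  have k2 : ∫ t in (0 : ℝ)..1, (Ω ^ 2 * (t * (perturbed U ε t * ψ' t ^ 2)) +
        t * ((∫ s in (1 : ℝ)..t, ζ' s) ^ 2 + 1 / B * ζ' t ^ 2)) =
      Ω ^ 2 * (∫ t in (0 : ℝ)..1, t * (U t * ψ' t ^ 2)) +
      (∫ t in (0 : ℝ)..1, t * ((∫ s in (1 : ℝ)..t, ζ' s) ^ 2 + 1 / B * ζ' t ^ 2)) +
      Ω ^ 2 * ε * C := by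
    rw [hC, ← intervalIntegral.integral_const_mul, ← intervalIntegral.integral_const_mul,
      ← intervalIntegral.integral_add (hI1.const_mul _) hI3,
      ← intervalIntegral.integral_add ((hI1.const_mul _).add hI3) (hI2.const_mul _)]
    refine intervalIntegral.integral_congr fun t _ => ?_
    simp only [perturbed]
    ring
  rw [k1, k2] at key
  have hsmall : Ω ^ 2 * ε * C ≤ δ := by
    have h1 : Ω ^ 2 * ε * C ≤ Ω ^ 2 * ε * |C| := by gcongr; exact le_abs_self C
    have h2 : ε * (Ω ^ 2 * |C| + 1) = δ := div_mul_cancel₀ _ hden.ne'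
    nlinarith
  linarith

end IsReducedProfile

/-! ### Bounds for the fundamental frequency -/

lemma memLp_radialMeasure_of_continuous {u : ℝ → ℝ} (hu : Continuous u) :
    MemLp u 2 radialMeasure := by
  obtain ⟨C, hC⟩ := isCompact_Icc.exists_bound_of_continuousOn (s := Icc (0 : ℝ) 1)
    hu.continuousOn
  refine MemLp.of_bound hu.aestronglyMeasurable C ?_
  rw [ae_radialMeasure_iff, ae_restrict_iff' measurableSet_Ioo]
  exact Filter.Eventually.of_forall fun r hr => hC r (Ioo_subset_Icc_self hr)

lemma memH11_of_hasDerivAt {u u' : ℝ → ℝ} (hd : ∀ r, HasDerivAt u (u' r) r)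
    (hu' : Continuous u') : MemH11 u u' where
  memLp := memLp_radialMeasure_of_continuous
    (continuous_iff_continuousAt.2 fun r => (hd r).continuousAt)
  memLp_deriv := memLp_radialMeasure_of_continuous hu'
  weakDeriv := by
    intro η hη hηc hηs
    have h0 : η 0 = 0 := image_eq_zero_of_notMem_tsupport fun h => lt_irrefl _ (hηs h).1
    have h1 : η 1 = 0 := image_eq_zero_of_notMem_tsupport fun h => lt_irrefl _ (hηs h).2
    have hη1 : ContDiff ℝ 1 η := hη.of_le (by exact_mod_cast le_top)
    have := intervalIntegral.integral_mul_deriv_eq_deriv_mul (a := (0 : ℝ)) (b := 1)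
      (fun r _ => hd r) (fun r _ => (hη1.differentiable one_ne_zero r).hasDerivAt)
      (hu'.intervalIntegrable _ _) ((hη1.continuous_deriv le_rfl).intervalIntegrable _ _)
    rw [← integral_Ioc_eq_integral_Ioo, ← integral_Ioc_eq_integral_Ioo,
      ← intervalIntegral.integral_of_le zero_le_one, ← intervalIntegral.integral_of_le zero_le_one,
      this, h0, h1]
    simp

lemma energy_nonneg {B : ℝ} (hB : 0 < B) {h : ℝ → ℝ} (hh : ∀ r ∈ Icc (0 : ℝ) 1, 0 ≤ h r)
    (ψ' ζ ζ' : ℝ → ℝ) : 0 ≤ energy B h ψ' ζ ζ' := by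
  unfold energy
  have h1 : 0 ≤ ∫ r, h r * ψ' r ^ 2 ∂radialMeasure := by
    refine integral_nonneg_of_ae ?_
    refine (ae_radialMeasure_iff _).2 ((ae_restrict_iff' measurableSet_Ioo).2 ?_)
    exact Filter.Eventually.of_forall fun r hr =>
      mul_nonneg (hh r (Ioo_subset_Icc_self hr)) (sq_nonneg _)
  have h2 : 0 ≤ ∫ r, (ζ r ^ 2 + 1 / B * ζ' r ^ 2) ∂radialMeasure :=
    integral_nonneg fun r => by positivity
  positivity

namespace IsReducedProfile

variable {B d : ℝ} {U p g : ℝ → ℝ}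

/-- The optimal trial pair: the potential is linear in `r`, so that its contribution to the energy
depends on the shape only through the volume. -/
lemma isTrialPair (h : IsReducedProfile B d U p g) (hB : B ≠ 0) (a b : ℝ) :
    IsTrialPair (fun r => a * r) (fun _ => a) (fun r => -b * p r) (fun r => -b * g r) where
  potential := memH11_of_hasDerivAt (fun r => by simpa using (hasDerivAt_id r).const_mul a)
    continuous_const
  height := memH11_of_hasDerivAt (fun r => (h.deriv_p r).const_mul (-b))
    (continuous_const.mul h.continuous_g)
  pinned := ⟨fun r => -b * p r, (continuous_const.mul h.continuous_p).continuousOn,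
    Filter.EventuallyEq.rfl, by simp [h.p_one]⟩
  mean_zero := by
    rw [integral_const_mul, integral_radialMeasure, h.integral_mul_p hB, mul_zero]

lemma integral_trial_mul (h : IsReducedProfile B d U p g) (hB : B ≠ 0) (a b : ℝ) :
    ∫ r, a * r * (-b * p r) ∂radialMeasure = a * b * mass U := by
  have e : (fun r => a * r * (-b * p r)) = fun r => -(a * b) * (r * p r) := by
    ext r; ring
  rw [e, integral_const_mul, integral_radialMeasure, h.integral_sq_mul_p hB]
  ring

lemma energy_trial (h : IsReducedProfile B d U p g) (hB : B ≠ 0) {V : ℝ} {H : ℝ → ℝ}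
    (hH : ∫ r, H r ∂radialMeasure = V / (2 * Real.pi)) (a b : ℝ) :
    energy B H (fun _ => a) (fun r => -b * p r) (fun r => -b * g r) =
      1 / 2 * (a ^ 2 * (V / (2 * Real.pi))) + 1 / 2 * (b ^ 2 * mass U) := by
  have e : (fun r => (-b * p r) ^ 2 + 1 / B * (-b * g r) ^ 2) =
      fun r => b ^ 2 * (p r ^ 2 + 1 / B * g r ^ 2) := by
    ext r; ring
  rw [energy, e, integral_mul_const, integral_const_mul, hH, integral_radialMeasure,
    h.integral_energy hB]
  ring

lemma fundamentalFrequency_le (h : IsReducedProfile B d U p g) (hB : 0 < B) {V : ℝ} (hV : 0 < V)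
    {H : ℝ → ℝ} (hH : H ∈ shapeClass V) :
    fundamentalFrequency B H ≤ √(V / (2 * Real.pi * mass U)) := by
  have hM := h.mass_pos hB
  set l := V / (2 * Real.pi * mass U) with hl
  have hl0 : 0 < l := by positivity
  -- `a ^ 2 V / 2π = b ^ 2 M` and `a b M = 1` make both halves of the energy equal
  set b := √(√l / mass U) with hb
  have hb2 : b ^ 2 = √l / mass U := Real.sq_sqrt (by positivity)
  have hb0 : 0 < b := Real.sqrt_pos.2 (by positivity)
  set a := 1 / (b * mass U) with ha
  refine csInf_le ⟨0, ?_⟩ ⟨_, _, _, _, h.isTrialPair hB.ne' a b, ?_, ?_⟩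
  · rintro e ⟨ψ, ψ', ζ, ζ', -, -, rfl⟩
    exact energy_nonneg hB hH.2.1 _ _ _
  · rw [h.integral_trial_mul hB.ne', ha]
    field_simp
  · rw [h.energy_trial hB.ne' hH.2.2]
    have hs : √l * √l = l := Real.mul_self_sqrt hl0.le
    have hV' : V / (2 * Real.pi) = √l * √l * mass U := by
      rw [hs, hl]; field_simp
    have hsl : √l ≠ 0 := (Real.sqrt_pos.2 hl0).ne'
    have ha2 : a ^ 2 = 1 / (√l * mass U) := by
      rw [ha, div_pow, mul_pow, hb2]; field_simp
    rw [ha2, hb2, hV']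
    field_simp
    ring

lemma fundamentalEigenvalue_le (h : IsReducedProfile B d U p g) (hB : 0 < B) {V : ℝ} (hV : 0 < V)
    {H : ℝ → ℝ} (hH : H ∈ shapeClass V) :
    fundamentalEigenvalue B H ≤ V / (2 * Real.pi * mass U) := by
  have hM := h.mass_pos hB
  have h0 : 0 ≤ fundamentalFrequency B H := by
    refine Real.sInf_nonneg ?_
    rintro e ⟨ψ, ψ', ζ, ζ', -, -, rfl⟩
    exact energy_nonneg hB hH.2.1 _ _ _
  calc fundamentalFrequency B H ^ 2 ≤ √(V / (2 * Real.pi * mass U)) ^ 2 := by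
        gcongr
        exact h.fundamentalFrequency_le hB hV hH
    _ = _ := Real.sq_sqrt (by positivity)

lemma mul_mem_shapeClass (h : IsReducedProfile B d U p g) (hB : 0 < B) {V : ℝ} (hV : 0 < V) :
    (fun r => V / (2 * Real.pi * mass U) * U r) ∈ shapeClass V := by
  have hM := h.mass_pos hB
  have hU : ContDiff ℝ 1 fun r => V / (2 * Real.pi * mass U) * U r :=
    contDiff_const.mul h.contDiff_U
  refine ⟨⟨hU.continuous.continuousOn, ∅, fun c d _ _ _ _ => hU.contDiffOn⟩, fun r hr => ?_, ?_⟩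
  · exact mul_nonneg (by positivity) (h.U_nonneg hB hr)
  · rw [integral_const_mul, integral_radialMeasure]
    change _ * mass U = _
    field_simp

lemma fundamentalEigenvalue_eq (h : IsReducedProfile B d U p g) (hB : 0 < B) {V : ℝ}
    (hV : 0 < V) :
    fundamentalEigenvalue B (fun r => V / (2 * Real.pi * mass U) * U r) =
      V / (2 * Real.pi * mass U) := by
  have hM := h.mass_pos hB
  refine le_antisymm (h.fundamentalEigenvalue_le hB hV (h.mul_mem_shapeClass hB hV)) ?_
  set l := V / (2 * Real.pi * mass U) with hl
  have hl0 : 0 ≤ l := by positivity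
  have hle : √l ≤ fundamentalFrequency B (fun r => l * U r) := by
    refine le_csInf ⟨_, _, _, _, _, h.isTrialPair hB.ne' 1 (1 / mass U), ?_, rfl⟩ ?_
    · rw [h.integral_trial_mul hB.ne']
      field_simp
    · rintro e ⟨ψ, ψ', ζ, ζ', ht, h1, rfl⟩
      have key := h.energy_inequality hB (√l) ht
      rw [h1, Real.sq_sqrt hl0, ← integral_const_mul] at key
      simp only [← mul_assoc] at key
      unfold energy
      linarith
  calc l = √l ^ 2 := (Real.sq_sqrt hl0).symm
    _ ≤ fundamentalFrequency B (fun r => l * U r) ^ 2 := by gcongr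

end IsReducedProfile

/-! ### The explicit profile -/

/-- The coefficient of `I₁(√B r)` in the explicit solution. -/
noncomputable def besselAmplitude (B : ℝ) : ℝ :=
  ((1 - dZero B) * √B - Real.pi / 2 * struveL 0 √B) / besselI 0 √B

/-- The slope of the optimal surface height, up to sign. -/
noncomputable def reducedSlope (B r : ℝ) : ℝ :=
  Real.pi / 2 * struveL 1 (√B * r) + besselAmplitude B * besselI 1 (√B * r)

/-- The optimal surface height, up to sign. -/
noncomputable def reducedHeight (B r : ℝ) : ℝ :=
  dZero B - r + besselAmplitude B / √B * besselI 0 (√B * r) +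
    Real.pi / (2 * √B) * struveL 0 (√B * r)

/-- The optimal shape divided by the optimal eigenvalue. -/
noncomputable def reducedShape (B r : ℝ) : ℝ :=
  dZero B * r / 2 - r ^ 2 / 3 + reducedSlope B r / B

/-- The recurrences of the Bessel and Struve functions give the differential equations, the amplitude
of `I₁` gives `p 1 = 0`, and the choice of `d₀` gives `U 1 = 0`. -/
lemma isReducedProfile_reducedShape {B : ℝ} (hB : 0 < B) :
    IsReducedProfile B (dZero B) (reducedShape B) (reducedHeight B) (reducedSlope B) := by
  have hκ : 0 < √B := Real.sqrt_pos.2 hB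
  have hκ2 : √B * √B = B := Real.mul_self_sqrt hB.le
  have hI0 := besselI_pos 0 hκ
  have hlin : ∀ r, HasDerivAt (fun r : ℝ => √B * r) √B r := fun r => by
    simpa using (hasDerivAt_id r).const_mul √B
  refine ⟨fun r => rfl, fun r => ?_, fun r => ?_, ?_, ?_, ?_⟩
  · have h1 := ((hasDerivAt_besselI_zero (√B * r)).comp r (hlin r)).const_mul
      (besselAmplitude B / √B)
    have h2 := ((hasDerivAt_struveL_zero (√B * r)).comp r (hlin r)).const_mul
      (Real.pi / (2 * √B))
    refine ((((hasDerivAt_id r).const_sub (dZero B)).add h1).add h2).congr_deriv ?_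
    unfold reducedSlope
    field_simp
    ring
  · have h1 := ((hasDerivAt_mul_besselI_one (√B * r)).comp r (hlin r)).const_mul
      (besselAmplitude B / √B)
    have h2 := ((hasDerivAt_mul_struveL_one (√B * r)).comp r (hlin r)).const_mul
      (Real.pi / (2 * √B))
    have e : (fun r => r * reducedSlope B r) = fun r =>
        Real.pi / (2 * √B) * ((fun x => x * struveL 1 x) ∘ fun r => √B * r) r +
        besselAmplitude B / √B * ((fun x => x * besselI 1 x) ∘ fun r => √B * r) r := by
      ext r
      simp only [reducedSlope, Function.comp]
      field_simp
    rw [e]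
    refine (h2.add h1).congr_deriv ?_
    unfold reducedHeight
    generalize √B = k at hκ2 hκ ⊢
    subst hκ2
    field_simp
    ring
  · have h1 := contDiff_struveL_one
    have h2 := contDiff_besselI_one
    unfold reducedSlope
    fun_prop
  · unfold reducedHeight besselAmplitude
    simp only [mul_one]
    field_simp
    ring
  · have hI2 := besselI_pos 2 hκ
    have e2 := mul_besselI_two √B
    have hd : dZero B * (3 * B * besselI 2 √B) =
        3 * Real.pi * upsilon √B + 2 * B * besselI 0 √B - 6 * √B * besselI 1 √B := by
      unfold dZero
      exact div_mul_cancel₀ _ (by positivity)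
    have hd' : dZero B * (3 * B * besselI 0 √B - 6 * √B * besselI 1 √B) =
        3 * Real.pi * upsilon √B + 2 * B * besselI 0 √B - 6 * √B * besselI 1 √B := by
      rw [← hd]
      have : B * besselI 2 √B = B * besselI 0 √B - 2 * √B * besselI 1 √B := by
        calc B * besselI 2 √B = √B * (√B * besselI 2 √B) := by rw [← mul_assoc, hκ2]
          _ = (√B * √B) * besselI 0 √B - 2 * √B * besselI 1 √B := by rw [e2]; ring
          _ = _ := by rw [hκ2]
      linear_combination (-3 * dZero B) * this
    unfold reducedShape reducedSlope besselAmplitude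
    unfold upsilon at hd'
    simp only [mul_one, one_pow]
    generalize dZero B = D at hd' ⊢
    field_simp
    linear_combination hd'

/-- The bracket in the definition of `lambdaStar` is `36 ∫ U r dr`; the hypergeometric function is the
first moment of `L₁`. -/
lemma mass_reducedShape {B : ℝ} (hB : 0 < B) :
    36 * IsReducedProfile.mass (reducedShape B) =
      6 * dZero B - 3
      + 18 * (1 - dZero B) * Real.pi * upsilon √B / (B * besselI 0 √B)
      + 3 * hypergeometricPFQ [1, 2] [3 / 2, 5 / 2, 3] (B / 4)
      - 9 * Real.pi ^ 2 * struveL 0 √B * upsilon √B / (√B ^ 3 * besselI 0 √B) := by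
  have hκ : 0 < √B := Real.sqrt_pos.2 hB
  have hκ2 : √B * √B = B := Real.mul_self_sqrt hB.le
  have hI0 := besselI_pos 0 hκ
  have hI := integral_mul_besselI_one hκ.ne'
  have hL := integral_mul_struveL_one hκ.ne'
  have hcI := contDiff_besselI_one.continuous
  have hcL := contDiff_struveL_one.continuous
  have e : IsReducedProfile.mass (reducedShape B) =
      dZero B / 2 * (∫ r in (0 : ℝ)..1, r ^ 2) - 1 / 3 * (∫ r in (0 : ℝ)..1, r ^ 3) +
      Real.pi / (2 * B) * (∫ r in (0 : ℝ)..1, r * struveL 1 (√B * r)) +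
      besselAmplitude B / B * ∫ r in (0 : ℝ)..1, r * besselI 1 (√B * r) := by
    rw [IsReducedProfile.mass, ← intervalIntegral.integral_const_mul,
      ← intervalIntegral.integral_const_mul, ← intervalIntegral.integral_const_mul,
      ← intervalIntegral.integral_const_mul, ← intervalIntegral.integral_sub,
      ← intervalIntegral.integral_add, ← intervalIntegral.integral_add]
    · refine intervalIntegral.integral_congr fun r _ => ?_
      simp only [reducedShape, reducedSlope]
      field_simp
      ring
    all_goals exact Continuous.intervalIntegrable (by fun_prop) _ _
  rw [e, hI, hL, integral_pow, integral_pow, Real.sq_sqrt hB.le]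
  unfold besselAmplitude
  generalize hypergeometricPFQ [1, 2] [3 / 2, 5 / 2, 3] (B / 4) = F
  generalize upsilon √B = Y
  generalize dZero B = D
  generalize besselI 0 √B = i at hI0 ⊢
  generalize struveL 0 √B = s
  generalize √B = k at hκ2 hκ ⊢
  subst hκ2
  norm_num
  field_simp
  ring

lemma lambdaStar_eq (B V : ℝ) (hB : 0 < B) :
    lambdaStar B V = V / (2 * Real.pi * IsReducedProfile.mass (reducedShape B)) := by
  have hM := (isReducedProfile_reducedShape hB).mass_pos hB
  rw [lambdaStar, ← mass_reducedShape hB]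
  field_simp
  ring

lemma optimalShape_eq (B V : ℝ) (hB : 0 < B) :
    optimalShape B V = fun r => lambdaStar B V * reducedShape B r := by
  have hκ : 0 < √B := Real.sqrt_pos.2 hB
  have hκ2 : √B * √B = B := Real.mul_self_sqrt hB.le
  have hI0 := besselI_pos 0 hκ
  ext r
  unfold optimalShape reducedShape reducedSlope besselAmplitude
  generalize lambdaStar B V = l
  generalize dZero B = D
  generalize besselI 0 √B = i at hI0 ⊢
  generalize struveL 0 √B = s
  generalize √B = k at hκ2 hκ ⊢
  subst hκ2
  field_simp
  ring

end Sloshing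

theorem theorem1p5 (B V : ℝ) (hB : 0 < B) (hV : 0 < V) :
    (∀ h ∈ Sloshing.shapeClass V,
      Sloshing.fundamentalEigenvalue B h ≤ Sloshing.lambdaStar B V) ∧
    Sloshing.optimalShape B V ∈ Sloshing.shapeClass V ∧
    Sloshing.fundamentalEigenvalue B (Sloshing.optimalShape B V) = Sloshing.lambdaStar B V ∧
    Sloshing.optimalShape B V 0 = 0 ∧
    ¬ ConvexOn ℝ (Set.Icc (0 : ℝ) 1) (fun r => -Sloshing.optimalShape B V r) := by
  have hP := Sloshing.isReducedProfile_reducedShape hB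
  have hM := hP.mass_pos hB
  rw [Sloshing.optimalShape_eq B V hB, Sloshing.lambdaStar_eq B V hB]
  refine ⟨fun h hh => hP.fundamentalEigenvalue_le hB hV hh, hP.mul_mem_shapeClass hB hV,
    hP.fundamentalEigenvalue_eq hB hV, by simp [hP.U_zero], fun hc => ?_⟩
  set l := V / (2 * Real.pi * Sloshing.IsReducedProfile.mass (Sloshing.reducedShape B)) with hl
  have hl0 : 0 < l := by positivity
  refine hP.not_convexOn_neg hB ?_
  have := hc.smul (inv_pos.2 hl0).le
  refine this.congr fun r _ => ?_
  simp only [smul_eq_mul]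
  field_simp
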